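/- Let $N\ge 2$, let $e_{k,l}$ be the matrix units, $\alpha_{k,l}=e_{k,k}-e_{l,l}$ ($1\le k<l\le N$) the positive roots of $sl_N(\mathbb C)$ and $\alpha_p=\alpha_{p,p+1}$ the simple roots. Let $V_1,\dots,V_n$ be highest weight $sl_N$-modules with highest weight vectors $v_1,\dots,v_n$. Fix integers $m_1,\dots,m_{N-1}\ge 0$ and put $\nu_0=\sum_p m_p\alpha_p$. Let $z=(z_1,\dots,z_n)$ and $t=(t_p^{(d)})$, $1\le p\le N-1$, $1\le d\le m_p$, be complex variables. **Indices.** $P(\nu_0,n)$ is the set of $I=(I_1,\dots,I_n)$, $I_j=(i^j_{l,k})_{k<l}$ with $i^j_{l,k}\in\mathbb Z_{\ge0}$, such that $\sum_j\sum_{k\le p<l} i^j_{l,k}=m_p$ for all $p=1,\dots,N-1$. Put $S(I)=\{(j,k,l,q): 1\le j\le n,\ 1\le k<l\le N,\ 1\le q\le i^j_{l,k}\}$ and $S_p(I)=\{(j,k,l,q)\in S(I): k\le p<l\}$, a set with $m_p$ elements. For every $I\in P(\nu_0,n)$ and every $p$ fix a bijection $\beta_p=\beta_p(I):S_p(I)\to\{1,\dots,m_p\}$.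 **Standard function.** The standard order is $\alpha_{k,l}\succ\alpha_{k',l'}$ iff $l>l'$, or $l=l'$ and $k>k'$. For $I_0=(i_{l,k})_{k<l}$ put $F_{I_0}=(-1)^{\sum i_{l,k}}\prod_{k<l} e_{l,k}^{\,i_{l,k}}/i_{l,k}!\in U(\mathfrak n_-)$, with the factors in decreasing standard order from left to right. For $s=(j,k,l,q)\in S(I)$ put $$f^{(s)}=\prod_{p=k}^{l-2}\frac1{t_p^{(\beta_p(s))}-t_{p+1}^{(\beta_{p+1}(s))}},\qquad \phi^{(s)}=\frac{f^{(s)}}{t_{l-1}^{(\beta_{l-1}(s))}-z_j},\qquad \phi(I)=\prod_{s\in S(I)}\phi^{(s)},$$ $$\phi(z,t)=\sum_{I\in P(\nu_0,n)}\phi(I)\,F_{I_1}v_1\otimes\cdots\otimes F_{I_n}v_n .$$ **Special functions.** For $h\in\{1,\dots,N-1\}$ let $A_h=\{\alpha_{k,l}:k\le h<l\}$, $B_h=\{\alpha_{k,l}: l\le h\}$, $C_h=\{\alpha_{k,l}: h<k\}$. Let $\succ_h$ be the order in which every element of $A_h$ is larger than every element of $B_h$, and every element of $A_h\cup B_h$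 is larger than every element of $C_h$; within $A_h$: $\alpha_{k,l}\succ_h\alpha_{k',l'}$ iff $l<l'$, or $l=l'$ and $k>k'$; within $B_h$: the standard order; within $C_h$: $\alpha_{k,l}\succ_h\alpha_{k',l'}$ iff $k<k'$, or $k=k'$ and $l<l'$. Let $a_{k,l}(h)$ be the number of $p$ with $k<p<l$ and $\alpha_{k,p}\succ_h\alpha_{p,l}$, let $F_{k,l}(h)=(-1)^{a_{k,l}(h)}e_{l,k}$, and put $F_{I_0}(h)=(-1)^{\sum i_{l,k}}\prod_{k<l} F_{k,l}(h)^{i_{l,k}}/i_{l,k}!$ with the factors in decreasing order with respect to $\succ_h$ from left to right (the PBW monomials of $U(\mathfrak n_-)$ for $\succ_h$). For $s=(j,k,l,q)\in S(I)$ put $$\phi_h^{(s)}=f^{(s)}\cdot\begin{cases}(-1)^{l-1-h}\big/\big(t_h^{(\beta_h(s))}-z_j\big), & k\le h<l,\\[2pt] 1\big/\big(t_{l-1}^{(\beta_{l-1}(s))}-z_j\big), & k<l\le h,\\[2pt] (-1)^{l-1-k}\big/\big(t_k^{(\beta_k(s))}-z_j\big), & h<k<l,\end{cases}\qquad \phi(I,h)=\prod_{s\in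 S(I)}\phi_h^{(s)},$$ $$\phi(z,t;h)=\sum_{I\in P(\nu_0,n)}\phi(I,h)\,F_{I_1}(h)v_1\otimes\cdots\otimes F_{I_n}(h)v_n .$$ **Theorem.** For every $h=1,\dots,N-1$, the order $\succ_h$ is normal (it is a linear order and, whenever $\alpha,\beta,\alpha+\beta$ are positive roots, $\alpha+\beta$ lies between $\alpha$ and $\beta$), and $$\phi(z,t;h)=\phi(z,t)$$ up to the relabelling symmetry of the variables $t$: for every choice of the bijections $\beta_p(I)$, the two $V_1\otimes\cdots\otimes V_n$-valued rational functions have the same symmetrization, $$\sum_{\sigma}\phi(z,\sigma t;h)=\sum_{\sigma}\phi(z,\sigma t),$$ where $\sigma$ runs over $\Sigma_{m_1}\times\cdots\times\Sigma_{m_{N-1}}$, acting by permutations of the coordinates $t_p^{(1)},\dots,t_p^{(m_p)}$ for each $p$. The identity holds at all points $(z,t)$ with $t_p^{(d)}\ne z_j$ and $t_p^{(d)}\ne t_{p+1}^{(d')}$ for all indices. -/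

import Mathlib

open scoped TensorProduct

noncomputable section

namespace MarkovVarchenko

/-! ## Positive roots of `sl_N` and orders on them

Rows and columns are numbered from `0`: the pair `(k, l)` below is the root `α_{k+1,l+1}` of the
one-based convention, and `p < N - 1` is the number of the simple root `α_{p+1}`. All inequalities
and differences of labels are unaffected by this common shift. -/

/-- The positive roots `α_{k,l}`, `k < l`, of `sl_N`. -/
abbrev PosRoot (N : ℕ) : Type := {a : Fin N × Fin N // a.1 < a.2}

/-- The lower label `k` of `α_{k,l}`. -/
def PosRoot.k {N : ℕ} (a : PosRoot N) : ℕ := a.1.1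

/-- The upper label `l` of `α_{k,l}`. -/
def PosRoot.l {N : ℕ} (a : PosRoot N) : ℕ := a.1.2

/-- The root `α_{k,l} = e_{k,k} - e_{l,l}`, as a vector of diagonal entries. -/
def PosRoot.vec {N : ℕ} (a : PosRoot N) : Fin N → ℤ := Pi.single a.1.1 1 - Pi.single a.1.2 1

/-- `k ≤ p < l`, i.e. the simple root number `p` occurs in `α_{k,l}`. -/
def PosRoot.Contains {N : ℕ} (a : PosRoot N) (p : ℕ) : Prop := a.k ≤ p ∧ p < a.l

instance {N : ℕ} (a : PosRoot N) (p : ℕ) : Decidable (a.Contains p) :=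
  inferInstanceAs (Decidable (_ ∧ _))

theorem PosRoot.lt_of_contains {N : ℕ} {a : PosRoot N} {p : ℕ} (h : a.Contains p) : p < N - 1 := by
  have h1 : p < (a.1.2 : ℕ) := h.2
  have h2 := a.1.2.isLt
  omega

/-- A normal order: a strict linear order in which `α + β` lies between `α` and `β` whenever
`α`, `β`, `α + β` are positive roots. -/
structure IsNormalOrder {N : ℕ} (gt : PosRoot N → PosRoot N → Prop) : Prop where
  irrefl : ∀ a, ¬ gt a a
  trans : ∀ a b c, gt a b → gt b c → gt a c
  total : ∀ a b, a ≠ b → gt a b ∨ gt b a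
  between : ∀ a b c, c.vec = a.vec + b.vec → (gt a c ∧ gt c b) ∨ (gt b c ∧ gt c a)

/-- The standard order `α_{k,l} ≻ α_{k',l'}`. -/
def StdGt {N : ℕ} (a b : PosRoot N) : Prop := b.l < a.l ∨ (a.l = b.l ∧ b.k < a.k)

instance {N : ℕ} : DecidableRel (StdGt (N := N)) := fun _ _ => inferInstanceAs (Decidable (_ ∨ _))

/-- The set `A_h`: roots with `k ≤ h < l`. -/
def InA {N : ℕ} (h : ℕ) (a : PosRoot N) : Prop := a.k ≤ h ∧ h < a.l

/-- The set `B_h`: roots with `l ≤ h`. -/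
def InB {N : ℕ} (h : ℕ) (a : PosRoot N) : Prop := a.l ≤ h

/-- The set `C_h`: roots with `h < k`. -/
def InC {N : ℕ} (h : ℕ) (a : PosRoot N) : Prop := h < a.k

/-- The order `≻_h`: first all of `A_h`, then all of `B_h`, then all of `C_h`, with the prescribed
order inside each of the three sets. -/
def SpecialGt {N : ℕ} (h : ℕ) (a b : PosRoot N) : Prop :=
  (InA h a ∧ InB h b) ∨ (InA h a ∧ InC h b) ∨ (InB h a ∧ InC h b) ∨
  (InA h a ∧ InA h b ∧ (a.l < b.l ∨ (a.l = b.l ∧ b.k < a.k))) ∨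
  (InB h a ∧ InB h b ∧ StdGt a b) ∨
  (InC h a ∧ InC h b ∧ (a.k < b.k ∨ (a.k = b.k ∧ a.l < b.l)))

instance {N : ℕ} (h : ℕ) : DecidableRel (SpecialGt (N := N) h) := fun a b => by
  unfold SpecialGt InA InB InC
  infer_instance

/-- The reflexive closure of a strict order. -/
def Weak {N : ℕ} (gt : PosRoot N → PosRoot N → Prop) (a b : PosRoot N) : Prop := a = b ∨ gt a b

instance {N : ℕ} (gt : PosRoot N → PosRoot N → Prop) [DecidableRel gt] : DecidableRel (Weak gt) :=
  fun _ _ => inferInstanceAs (Decidable (_ ∨ _))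

theorem PosRoot.ext_kl {N : ℕ} {a b : PosRoot N} (h1 : a.k = b.k) (h2 : a.l = b.l) : a = b :=
  Subtype.ext (Prod.ext (Fin.ext h1) (Fin.ext h2))

theorem PosRoot.k_lt_l {N : ℕ} (a : PosRoot N) : a.k < a.l := a.2

instance {N : ℕ} : IsTrans (PosRoot N) (Weak StdGt) where
  trans a b c h1 h2 := by
    rcases h1 with rfl | h1
    · exact h2
    rcases h2 with rfl | h2
    · exact Or.inr h1
    · right
      unfold StdGt at *
      omega

instance {N : ℕ} : Std.Antisymm (Weak (StdGt (N := N))) where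
  antisymm a b h1 h2 := by
    rcases h1 with h1 | h1
    · exact h1
    rcases h2 with h2 | h2
    · exact h2.symm
    · unfold StdGt at *
      omega

instance {N : ℕ} : Std.Total (Weak (StdGt (N := N))) where
  total a b := by
    by_cases h1 : a.k = b.k ∧ a.l = b.l
    · exact Or.inl (Or.inl (PosRoot.ext_kl h1.1 h1.2))
    · unfold Weak StdGt
      omega

instance {N : ℕ} (h : ℕ) : IsTrans (PosRoot N) (Weak (SpecialGt h)) where
  trans a b c h1 h2 := by
    rcases h1 with rfl | h1
    · exact h2
    rcases h2 with rfl | h2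
    · exact Or.inr h1
    · right
      have := a.k_lt_l
      have := b.k_lt_l
      have := c.k_lt_l
      unfold SpecialGt InA InB InC StdGt at *
      omega

instance {N : ℕ} (h : ℕ) : Std.Antisymm (Weak (SpecialGt (N := N) h)) where
  antisymm a b h1 h2 := by
    rcases h1 with h1 | h1
    · exact h1
    rcases h2 with h2 | h2
    · exact h2.symm
    · have := a.k_lt_l
      have := b.k_lt_l
      unfold SpecialGt InA InB InC StdGt at *
      omega

instance {N : ℕ} (h : ℕ) : Std.Total (Weak (SpecialGt (N := N) h)) where
  total a b := by
    by_cases h1 : a.k = b.k ∧ a.l = b.l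
    · exact Or.inl (Or.inl (PosRoot.ext_kl h1.1 h1.2))
    · have := a.k_lt_l
      have := b.k_lt_l
      rcases Nat.lt_or_ge h a.k with h2 | h2 <;> rcases Nat.lt_or_ge h a.l with h3 | h3 <;>
      rcases Nat.lt_or_ge h b.k with h4 | h4 <;> rcases Nat.lt_or_ge h b.l with h5 | h5 <;>
      first
      | (exfalso; omega)
      | (simp only [Weak, SpecialGt, InA, InB, InC, StdGt, h2, h3, h4, h5, not_lt.2, not_le.2,
          true_and, and_true, false_and, and_false, true_or, or_true, false_or, or_false] <;> omega)

/-! ## The Lie algebra, highest weight modules, PBW monomials -/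

/-- The Lie algebra `sl_N` over the complex numbers. -/
abbrev SL (N : ℕ) : Type := LieAlgebra.SpecialLinear.sl (Fin N) ℂ

/-- The Cartan subalgebra of traceless diagonal matrices. -/
def cartan (N : ℕ) : Submodule ℂ (SL N) where
  carrier := {x | ∀ i j : Fin N, i ≠ j → x.1 i j = 0}
  zero_mem' := fun _ _ _ => rfl
  add_mem' := fun {x y} hx hy i j hij => by
    change x.1 i j + y.1 i j = 0
    rw [hx i j hij, hy i j hij, add_zero]
  smul_mem' := fun c x hx i j hij => by
    change c * x.1 i j = 0
    rw [hx i j hij, mul_zero]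

/-- The root vector `e_{k,l}` of the positive root `α_{k,l}`. -/
def raising {N : ℕ} (a : PosRoot N) : SL N :=
  LieAlgebra.SpecialLinear.single a.1.1 a.1.2 (ne_of_lt a.2) 1

/-- The root vector `e_{l,k}` of the negative root `-α_{k,l}`. -/
def lowering {N : ℕ} (a : PosRoot N) : SL N :=
  LieAlgebra.SpecialLinear.single a.1.2 a.1.1 (ne_of_gt a.2) 1

/-- `V` is a highest weight module with highest weight `Λ` and highest weight vector `v`. -/
structure IsHighestWeightModule {N : ℕ} {V : Type*} [AddCommGroup V] [Module ℂ V]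
    [LieRingModule (SL N) V] [LieModule ℂ (SL N) V]
    (Λ : Module.Dual ℂ (cartan N)) (v : V) : Prop where
  ne_zero : v ≠ 0
  raising_eq_zero : ∀ a : PosRoot N, ⁅raising a, v⁆ = 0
  weight : ∀ x : cartan N, ⁅(x : SL N), v⁆ = Λ x • v
  generates : LieSubmodule.lieSpan ℂ (SL N) {v} = ⊤

/-- The universal enveloping algebra `U(sl_N)`. -/
abbrev UEA (N : ℕ) : Type := UniversalEnvelopingAlgebra ℂ (SL N)

/-- The action of `U(sl_N)` on an `sl_N`-module. -/
def act {N : ℕ} {V : Type*} [AddCommGroup V] [Module ℂ V]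
    [LieRingModule (SL N) V] [LieModule ℂ (SL N) V] (u : UEA N) (x : V) : V :=
  UniversalEnvelopingAlgebra.lift ℂ (LieModule.toEnd ℂ (SL N) V) u x

/-- For a linear order on the positive roots and elements `F_α` of `sl_N`, the monomial
`(-1)^{∑ i_α} ∏ F_α^{i_α} / i_α!` in `U(sl_N)`, the factors standing in decreasing order of the
roots from left to right. -/
def pbwMonomial {N : ℕ} (gt : PosRoot N → PosRoot N → Prop) [DecidableRel gt]
    [IsTrans (PosRoot N) (Weak gt)] [Std.Antisymm (Weak gt)] [Std.Total (Weak gt)]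
    (F : PosRoot N → SL N) (i : PosRoot N → ℕ) : UEA N :=
  (-1 : ℂ) ^ (∑ a, i a) •
    (((Finset.univ : Finset (PosRoot N)).sort (Weak gt)).map fun a =>
      ((Nat.factorial (i a) : ℂ)⁻¹) • (UniversalEnvelopingAlgebra.ι ℂ (F a)) ^ (i a)).prod

/-- The standard PBW monomial `F_{I_0}`. -/
def stdMonomial {N : ℕ} (i : PosRoot N → ℕ) : UEA N := pbwMonomial StdGt lowering i

/-- `a_{k,l}(h)`: the number of `p` with `k < p < l` and `α_{k,p} ≻_h α_{p,l}`. -/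
def flips {N : ℕ} (h : ℕ) (a : PosRoot N) : ℕ :=
  Fintype.card {p : Fin N // ∃ (h1 : a.1.1 < p) (h2 : p < a.1.2),
    SpecialGt h (⟨(a.1.1, p), h1⟩ : PosRoot N) (⟨(p, a.1.2), h2⟩ : PosRoot N)}

/-- `F_{k,l}(h) = (-1)^{a_{k,l}(h)} e_{l,k}`. -/
def specialLowering {N : ℕ} (h : ℕ) (a : PosRoot N) : SL N := (-1 : ℂ) ^ flips h a • lowering a

/-- The PBW monomial `F_{I_0}(h)` corresponding to the order `≻_h`. -/
def specialMonomial {N : ℕ} (h : ℕ) (i : PosRoot N → ℕ) : UEA N :=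
  pbwMonomial (SpecialGt h) (specialLowering h) i

/-! ## Index sets -/

/-- A tuple `I = (I_1, …, I_n)` of families of non-negative integers `i^j_{l,k}`. -/
abbrev Idx (N n : ℕ) : Type := Fin n → PosRoot N → ℕ

/-- The set `P(ν_0, n)`, where `ν_0 = ∑ m_p α_p`; see `mem_P`. The bound on the entries only serves
to present this finite set as a `Finset`. -/
def P (N n : ℕ) (m : Fin (N - 1) → ℕ) : Finset (Idx N n) :=
  (Fintype.piFinset fun _ => Fintype.piFinset fun _ => Finset.range (∑ p, m p + 1)).filter
    fun I => ∀ p : Fin (N - 1), (∑ j, ∑ a with a.Contains p, I j a) = m p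

theorem single_le_sum_nat {ι : Type*} [Fintype ι] (f : ι → ℕ) (i : ι) : f i ≤ ∑ i, f i :=
  Finset.single_le_sum_of_canonicallyOrdered (Finset.mem_univ i)

theorem mem_P {N n : ℕ} {m : Fin (N - 1) → ℕ} {I : Idx N n} :
    I ∈ P N n m ↔ ∀ p : Fin (N - 1), (∑ j, ∑ a with a.Contains p, I j a) = m p := by
  have key : ∀ (a : PosRoot N) (j : Fin n) (p : Fin (N - 1)), a.Contains p →
      (∑ j, ∑ a with a.Contains p, I j a) = m p → I j a ≤ ∑ p, m p := by
    intro a j p ha hI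
    have h1 : I j a ≤ ∑ b with b.Contains p, I j b :=
      Finset.single_le_sum_of_canonicallyOrdered (f := I j)
        (Finset.mem_filter.2 ⟨Finset.mem_univ a, ha⟩)
    have h2 := single_le_sum_nat (fun j => ∑ b with b.Contains p, I j b) j
    have h3 := single_le_sum_nat m p
    exact (h1.trans h2).trans (hI.trans_le h3)
  unfold P
  rw [Finset.mem_filter, and_iff_right_iff_imp]
  intro hI
  rw [Fintype.mem_piFinset]
  intro j
  rw [Fintype.mem_piFinset]
  intro a
  rw [Finset.mem_range]
  have ha : a.Contains a.k := And.intro (Nat.le_refl _) a.k_lt_l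
  exact Nat.lt_succ_of_le (key a j (Fin.mk a.k (PosRoot.lt_of_contains ha)) ha (hI _))

/-- The set `S(I)` of quadruples `(j, k, l, q)` with `1 ≤ q ≤ i^j_{l,k}`. -/
abbrev S {N n : ℕ} (I : Idx N n) : Type := Σ x : Fin n × PosRoot N, Fin (I x.1 x.2)

/-- The set `S_p(I)` of those `(j, k, l, q)` in `S(I)` with `k ≤ p < l`. -/
abbrev SAt {N n : ℕ} (I : Idx N n) (p : ℕ) : Type := {s : S I // s.1.2.Contains p}

/-- A choice of bijections `β_p(I) : S_p(I) → {1, …, m_p}` for every `I ∈ P(ν_0, n)` and every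
`p`. -/
abbrev Labelling (N n : ℕ) (m : Fin (N - 1) → ℕ) : Type :=
  ∀ (I : P N n m) (p : Fin (N - 1)), SAt I.1 p ≃ Fin (m p)

/-! ## The rational functions -/

/-- The points `t = (t_p^{(d)})`. -/
abbrev Pt (N : ℕ) (m : Fin (N - 1) → ℕ) : Type := ∀ p : Fin (N - 1), Fin (m p) → ℂ

section

variable {N n : ℕ} {m : Fin (N - 1) → ℕ}

/-- The coordinate `t_p^{(β_p(I)(s))}` of `t`. It is only used for `s ∈ S_p(I)`. -/
def coord (β : Labelling N n m) (I : P N n m) (t : Pt N m) (s : S I.1) (p : ℕ) : ℂ :=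
  if hs : s.1.2.Contains p then
    t ⟨p, PosRoot.lt_of_contains hs⟩ (β I ⟨p, PosRoot.lt_of_contains hs⟩ ⟨s, hs⟩)
  else 0

/-- `f^{(s)} = ∏_{p=k}^{l-2} 1 / (t_p^{(β_p(s))} - t_{p+1}^{(β_{p+1}(s))})`. -/
def chain (β : Labelling N n m) (I : P N n m) (t : Pt N m) (s : S I.1) : ℂ :=
  ∏ p ∈ Finset.Ico s.1.2.k (s.1.2.l - 1), 1 / (coord β I t s p - coord β I t s (p + 1))

/-- `φ^{(s)}`. -/
def stdFactor (β : Labelling N n m) (I : P N n m) (z : Fin n → ℂ) (t : Pt N m) (s : S I.1) : ℂ :=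
  chain β I t s * (1 / (coord β I t s (s.1.2.l - 1) - z s.1.1))

/-- `φ_h^{(s)}`. -/
def specialFactor (h : ℕ) (β : Labelling N n m) (I : P N n m) (z : Fin n → ℂ) (t : Pt N m)
    (s : S I.1) : ℂ :=
  if h < s.1.2.k then
    chain β I t s * ((-1) ^ (s.1.2.l - 1 - s.1.2.k) / (coord β I t s s.1.2.k - z s.1.1))
  else if h < s.1.2.l then
    chain β I t s * ((-1) ^ (s.1.2.l - 1 - h) / (coord β I t s h - z s.1.1))
  else
    chain β I t s * (1 / (coord β I t s (s.1.2.l - 1) - z s.1.1))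

/-- `φ(I) = ∏_{s ∈ S(I)} φ^{(s)}`. -/
def stdCoeff (β : Labelling N n m) (I : P N n m) (z : Fin n → ℂ) (t : Pt N m) : ℂ :=
  ∏ s : S I.1, stdFactor β I z t s

/-- `φ(I, h) = ∏_{s ∈ S(I)} φ_h^{(s)}`. -/
def specialCoeff (h : ℕ) (β : Labelling N n m) (I : P N n m) (z : Fin n → ℂ) (t : Pt N m) : ℂ :=
  ∏ s : S I.1, specialFactor h β I z t s

variable {V : Fin n → Type*} [∀ j, AddCommGroup (V j)] [∀ j, Module ℂ (V j)]
  [∀ j, LieRingModule (SL N) (V j)] [∀ j, LieModule ℂ (SL N) (V j)]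

/-- `φ(z, t) = ∑_I φ(I) F_{I_1} v_1 ⊗ ⋯ ⊗ F_{I_n} v_n`. -/
def phi (β : Labelling N n m) (v : ∀ j, V j) (z : Fin n → ℂ) (t : Pt N m) : ⨂[ℂ] j, V j :=
  ∑ I : P N n m, stdCoeff β I z t •
    PiTensorProduct.tprod ℂ (fun j => act (stdMonomial (I.1 j)) (v j))

/-- `φ(z, t; h) = ∑_I φ(I, h) F_{I_1}(h) v_1 ⊗ ⋯ ⊗ F_{I_n}(h) v_n`. -/
def phiSpecial (h : ℕ) (β : Labelling N n m) (v : ∀ j, V j) (z : Fin n → ℂ) (t : Pt N m) :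
    ⨂[ℂ] j, V j :=
  ∑ I : P N n m, specialCoeff h β I z t •
    PiTensorProduct.tprod ℂ (fun j => act (specialMonomial h (I.1 j)) (v j))

end

/-- `t` lies outside the union of the hyperplanes `t_p^{(d)} = z_j` and
`t_p^{(d)} = t_{p+1}^{(d')}`, so that no denominator vanishes at `(z, t)`. -/
def Regular {N n : ℕ} {m : Fin (N - 1) → ℕ} (z : Fin n → ℂ) (t : Pt N m) : Prop :=
  (∀ p d j, t p d ≠ z j) ∧
    ∀ p q : Fin (N - 1), (q : ℕ) = p + 1 → ∀ d d', t p d ≠ t q d'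

/-- The symmetrization over `Σ_{m_1} × ⋯ × Σ_{m_{N-1}}`, which permutes the coordinates `t_p^{(d)}`
of `t` for every fixed `p`. -/
def symmetrize {N : ℕ} {m : Fin (N - 1) → ℕ} {W : Type*} [AddCommMonoid W] (f : Pt N m → W)
    (t : Pt N m) : W :=
  ∑ σ : ∀ p : Fin (N - 1), Equiv.Perm (Fin (m p)), f (fun p d => t p (σ p d))

end MarkovVarchenko

end

open scoped TensorProduct

noncomputable section

namespace MarkovVarchenko

/-! ## Exponentials of nilpotent elements -/

section Exponential

variable {A : Type*} [Ring A] [Module ℚ A]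

/-! Both symmetrized sums are the coefficient of one monomial in a product of ordered exponentials,
so the theorem reduces to an identity between such products.

Attach to every variable `t p d` a commuting generator ε with ε² = 0. For a root a and a point ζ =
z_j, let X_e(a) (`gen`) be the sum, over all choices of one variable τ_p for each simple root p in
a, of ∏ 1/(τ_p - τ_{p+1}) · 1/(τ_e - ζ) times the product of the chosen ε. Because of the factorials
in the PBW monomials, expanding the ordered products of exp(-X_e(a) e_{l,k}), one for each tensor
factor, produces all the vectors of the sum. The coefficient of the product of all ε retains only
those choices that use each variable once; given the labelling these are the permutations σ
(`symmetrize_eq_topProj`). The signs in F_{k,l}(h) and in φ_h cancel (`phiSpecial_eq`). What remains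
of h is the order of the factors and the index e = `pivot h a`.

The ordered product does not change from h + 1 to h (`expProd_succ`). Let K, L, W_e be the sums of
-X E over the roots with k = h + 1, with l = h + 1, and with k ≤ h, h + 1 < l, the last ones taken
with index e. Apart from common factors, the two products are e^{W_{h+1}} e^K e^L and e^{W_h} e^L
e^K. Since [K, L] commutes with K and L, e^K e^L = e^{[K,L]} e^L e^K (`exp_mul_exp_of_central`), and
[K, L] = W_h - W_{h+1} by a partial fraction identity (`gen_relation`). For large h all roots lie in
B_h, where the order is the standard one and e = l - 1 (`expProd_eq_standard`).

Normality of the order is a separate finite case check. -/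

theorem list_prod_map_exp {ι : Type*} (x : ι → A) (l : List ι)
    (hx : ∀ a ∈ l, IsNilpotent (x a)) (hc : ∀ a ∈ l, ∀ b ∈ l, Commute (x a) (x b)) :
    (l.map fun a => IsNilpotent.exp (x a)).prod = IsNilpotent.exp (l.map x).sum ∧
      IsNilpotent (l.map x).sum := by
  induction l with
  | nil => exact ⟨IsNilpotent.exp_zero.symm, IsNilpotent.zero⟩
  | cons a l ih =>
    obtain ⟨h1, h2⟩ := ih (fun b hb => hx b (List.mem_cons_of_mem _ hb))
      fun b hb c hc' => hc b (List.mem_cons_of_mem _ hb) c (List.mem_cons_of_mem _ hc')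
    have h3 : Commute (x a) (l.map x).sum := by
      refine Commute.list_sum_right _ _ fun b hb => ?_
      obtain ⟨c, hc', rfl⟩ := List.mem_map.1 hb
      exact hc a List.mem_cons_self c (List.mem_cons_of_mem _ hc')
    have h4 := hx a List.mem_cons_self
    simp only [List.map_cons, List.prod_cons, List.sum_cons]
    exact ⟨by rw [h1, IsNilpotent.exp_add_of_commute h3 h4 h2], h3.isNilpotent_add h4 h2⟩

/-- If `[x, y]` commutes with `x` and with `y`, then `e^x e^y = e^{[x, y]} e^y e^x`. -/
theorem exp_mul_exp_of_central {x y z : A} (hx : IsNilpotent x) (hy : IsNilpotent y)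
    (hz : IsNilpotent z) (hxy : x * y = y * x + z) (hxz : Commute x z) (hyz : Commute y z) :
    IsNilpotent.exp x * IsNilpotent.exp y =
      IsNilpotent.exp z * (IsNilpotent.exp y * IsNilpotent.exp x) := by
  -- Commutation with y acts on powers of x as z times the derivative.
  have hpow : ∀ q : ℕ, x ^ (q + 1) * y = y * x ^ (q + 1) + (q + 1 : ℕ) • (z * x ^ q) := by
    intro q
    induction q with
    | zero => simpa using hxy
    | succ q ih =>
      rw [pow_succ' x (q + 1), mul_assoc, ih, mul_add, ← mul_assoc, hxy, mul_smul_comm,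
        ← mul_assoc, hxz.eq, mul_assoc z, ← pow_succ', succ_nsmul _ (q + 1)]
      rw [add_mul, mul_assoc]
      abel
  -- Conjugation by e^x sends y to y + z. The left sum is cut at k + 1 and the z-term at k, because
  -- the derivative lowers the exponent by one.
  have hsemi : SemiconjBy (IsNilpotent.exp x) y (y + z) := by
    obtain ⟨k, hk⟩ := hx
    have hk1 : x ^ (k + 1) = 0 := by rw [pow_succ, hk, zero_mul]
    have e : IsNilpotent.exp x * y = y * IsNilpotent.exp x + z * IsNilpotent.exp x := by
      have e1 := IsNilpotent.exp_eq_sum hk1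
      have e2 := IsNilpotent.exp_eq_sum hk
      suffices h : (∑ q ∈ Finset.range (k + 1), (q.factorial : ℚ)⁻¹ • x ^ q) * y =
          y * (∑ q ∈ Finset.range (k + 1), (q.factorial : ℚ)⁻¹ • x ^ q) +
            z * ∑ q ∈ Finset.range k, (q.factorial : ℚ)⁻¹ • x ^ q by
        rwa [← e1, ← e2] at h
      rw [Finset.sum_range_succ', add_mul, mul_add, Finset.sum_mul,
        Finset.mul_sum, Finset.mul_sum]
      have : ∀ q ∈ Finset.range k, ((q + 1).factorial : ℚ)⁻¹ • x ^ (q + 1) * y =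
          y * (((q + 1).factorial : ℚ)⁻¹ • x ^ (q + 1)) +
            z * (((q.factorial : ℚ))⁻¹ • x ^ q) := by
        intro q _
        rw [smul_mul_assoc, hpow, smul_add, mul_smul_comm, mul_smul_comm,
          ← Nat.cast_smul_eq_nsmul ℚ, smul_smul]
        congr 2
        rw [Nat.factorial_succ]
        push_cast
        have h1 : (q : ℚ) + 1 ≠ 0 := by positivity
        have h2 : (q.factorial : ℚ) ≠ 0 := by positivity
        field_simp
      rw [Finset.sum_congr rfl this, Finset.sum_add_distrib]
      simp only [pow_zero, Nat.factorial_zero, Nat.cast_one, inv_one, one_smul, one_mul, mul_one]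
      abel
    rw [SemiconjBy, e, add_mul]
  have hexp : SemiconjBy (IsNilpotent.exp x) (IsNilpotent.exp y) (IsNilpotent.exp (y + z)) := by
    obtain ⟨k, hk⟩ := hy
    obtain ⟨k', hk'⟩ := hyz.isNilpotent_add ⟨k, hk⟩ hz
    have h1 : y ^ (max k k') = 0 := pow_eq_zero_of_le (le_max_left _ _) hk
    have h2 : (y + z) ^ (max k k') = 0 := pow_eq_zero_of_le (le_max_right _ _) hk'
    rw [IsNilpotent.exp_eq_sum h1, IsNilpotent.exp_eq_sum h2, SemiconjBy, Finset.mul_sum,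
      Finset.sum_mul]
    refine Finset.sum_congr rfl fun q _ => ?_
    rw [mul_smul_comm, smul_mul_assoc, (hsemi.pow_right q).eq]
  rw [hexp.eq, add_comm, IsNilpotent.exp_add_of_commute hyz.symm hz hy, mul_assoc]

end Exponential

/-! ## Ordered products over sets of positive roots -/

section OrderedProduct

variable {N : ℕ} {A : Type*}

/-- The product of `g a`, `a ∈ s`, in decreasing order of the roots from left to right. -/
def orderedProd [Monoid A] (gt : PosRoot N → PosRoot N → Prop) [DecidableRel gt]
    [IsTrans (PosRoot N) (Weak gt)] [Std.Antisymm (Weak gt)] [Std.Total (Weak gt)]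
    (s : Finset (PosRoot N)) (g : PosRoot N → A) : A :=
  ((s.sort (Weak gt)).map g).prod

section

variable [Monoid A] (gt : PosRoot N → PosRoot N → Prop) [DecidableRel gt]
    [IsTrans (PosRoot N) (Weak gt)] [Std.Antisymm (Weak gt)] [Std.Total (Weak gt)]

theorem orderedProd_union {s s₁ s₂ : Finset (PosRoot N)} {g : PosRoot N → A}
    (hs : s₁ ∪ s₂ = s) (hd : Disjoint s₁ s₂) (hgt : ∀ a ∈ s₁, ∀ b ∈ s₂, gt a b) :
    orderedProd gt s g = orderedProd gt s₁ g * orderedProd gt s₂ g := by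
  subst hs
  rw [orderedProd, orderedProd, orderedProd, ← List.prod_append, ← List.map_append]
  congr 2
  -- Two sorted lists that are permutations of each other are equal, so only sortedness of the
  -- concatenation matters.
  refine List.Perm.eq_of_pairwise' (r := Weak gt) (Finset.pairwise_sort _ _) ?_ ?_
  · rw [List.pairwise_append]
    refine ⟨Finset.pairwise_sort _ _, Finset.pairwise_sort _ _, fun a ha b hb => Or.inr ?_⟩
    exact hgt a ((Finset.mem_sort _).1 ha) b ((Finset.mem_sort _).1 hb)
  · rw [← Multiset.coe_eq_coe, ← Multiset.coe_add, Finset.sort_eq, Finset.sort_eq, Finset.sort_eq,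
      ← Finset.disjUnion_eq_union _ _ hd]
    rfl

theorem orderedProd_congr {gt' : PosRoot N → PosRoot N → Prop} [DecidableRel gt']
    [IsTrans (PosRoot N) (Weak gt')] [Std.Antisymm (Weak gt')] [Std.Total (Weak gt')]
    {s : Finset (PosRoot N)} {g g' : PosRoot N → A}
    (hgt : ∀ a ∈ s, ∀ b ∈ s, gt a b → gt' a b) (hg : ∀ a ∈ s, g a = g' a) :
    orderedProd gt s g = orderedProd gt' s g' := by
  have h1 : s.sort (Weak gt) = s.sort (Weak gt') := by
    refine List.Perm.eq_of_pairwise' (r := Weak gt') ?_ (Finset.pairwise_sort _ _) ?_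
    · refine (Finset.pairwise_sort s (Weak gt)).imp_of_mem fun {a b} ha hb hab => ?_
      exact hab.imp id (hgt a ((Finset.mem_sort _).1 ha) b ((Finset.mem_sort _).1 hb))
    · rw [← Multiset.coe_eq_coe, Finset.sort_eq, Finset.sort_eq]
  rw [orderedProd, orderedProd, h1]
  congr 1
  exact List.map_congr_left fun a ha => hg a ((Finset.mem_sort _).1 ha)

end

theorem orderedProd_commute [Monoid A] (gt : PosRoot N → PosRoot N → Prop) [DecidableRel gt]
    [IsTrans (PosRoot N) (Weak gt)] [Std.Antisymm (Weak gt)] [Std.Total (Weak gt)]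
    {s : Finset (PosRoot N)} {g : PosRoot N → A} {y : A} (hg : ∀ a ∈ s, Commute y (g a)) :
    Commute y (orderedProd gt s g) := by
  refine Commute.list_prod_right _ _ fun b hb => ?_
  obtain ⟨c, hc, rfl⟩ := List.mem_map.1 hb
  exact hg c ((Finset.mem_sort _).1 hc)

theorem orderedProd_exp [Ring A] [Module ℚ A] (gt : PosRoot N → PosRoot N → Prop) [DecidableRel gt]
    [IsTrans (PosRoot N) (Weak gt)] [Std.Antisymm (Weak gt)] [Std.Total (Weak gt)]
    {s : Finset (PosRoot N)} {x : PosRoot N → A} (hx : ∀ a, IsNilpotent (x a))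
    (hc : ∀ a ∈ s, ∀ b ∈ s, Commute (x a) (x b)) :
    orderedProd gt s (fun a => IsNilpotent.exp (x a)) = IsNilpotent.exp (∑ a ∈ s, x a) := by
  rw [orderedProd, (list_prod_map_exp x _ (fun a _ => hx a) fun a ha b hb =>
    hc a ((Finset.mem_sort _).1 ha) b ((Finset.mem_sort _).1 hb)).1]
  congr 1
  rw [← Multiset.sum_coe, ← Multiset.map_coe, Finset.sort_eq, Finset.sum]

end OrderedProduct

/-! ## The order `≻_h` is normal -/

theorem PosRoot.vec_apply {N : ℕ} (a : PosRoot N) (i : Fin N) :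
    a.vec i = (if (i : ℕ) = a.k then 1 else 0) - if (i : ℕ) = a.l then 1 else 0 := by
  simp only [PosRoot.vec, Pi.sub_apply, Pi.single_apply, Fin.ext_iff, PosRoot.k, PosRoot.l]
  rfl

theorem eq_of_vec_eq_add_of_eq {N : ℕ} {a b c : PosRoot N} (h : c.vec = a.vec + b.vec)
    (hk : c.k = a.k) : a.l = b.k ∧ c.l = b.l := by
  have ha := a.k_lt_l
  have hb := b.k_lt_l
  have hc := c.k_lt_l
  -- Two coordinates suffice: at b.k the entry +1 of b can only be cancelled by the entry -1 of a,
  -- which gives a.l = b.k. At c.l these two cancel, and the entry -1 of c must come from b.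
  have e3 := congrFun h b.1.1
  have e6 := congrFun h c.1.2
  rw [Pi.add_apply, PosRoot.vec_apply, PosRoot.vec_apply, PosRoot.vec_apply] at e3 e6
  change (if b.k = c.k then (1 : ℤ) else 0) - (if b.k = c.l then 1 else 0) =
    (if b.k = a.k then 1 else 0) - (if b.k = a.l then 1 else 0) +
    ((if b.k = b.k then 1 else 0) - (if b.k = b.l then 1 else 0)) at e3
  change (if c.l = c.k then (1 : ℤ) else 0) - (if c.l = c.l then 1 else 0) =
    (if c.l = a.k then 1 else 0) - (if c.l = a.l then 1 else 0) +
    ((if c.l = b.k then 1 else 0) - (if c.l = b.l then 1 else 0)) at e6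
  rw [hk, if_pos rfl, if_neg hb.ne] at e3
  have h1 : a.l = b.k := by
    by_contra hne
    rw [if_neg (Ne.symm hne)] at e3
    split_ifs at e3 <;> omega
  rw [if_neg hc.ne', if_pos rfl, if_neg (by omega : ¬ c.l = a.k), h1] at e6
  refine ⟨h1, ?_⟩
  by_contra hne
  rw [if_neg hne] at e6
  split_ifs at e6 <;> omega

theorem eq_of_vec_eq_add {N : ℕ} {a b c : PosRoot N} (h : c.vec = a.vec + b.vec) :
    (c.k = a.k ∧ a.l = b.k ∧ c.l = b.l) ∨ (c.k = b.k ∧ b.l = a.k ∧ c.l = a.l) := by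
  by_cases h1 : c.k = a.k
  · exact Or.inl ⟨h1, eq_of_vec_eq_add_of_eq h h1⟩
  by_cases h2 : c.k = b.k
  · exact Or.inr ⟨h2, eq_of_vec_eq_add_of_eq (by rw [h, add_comm]) h2⟩
  have hc := c.k_lt_l
  -- The entry of c at c.k is 1, so a or b must have its positive entry there.
  have e5 := congrFun h c.1.1
  rw [Pi.add_apply, PosRoot.vec_apply, PosRoot.vec_apply, PosRoot.vec_apply] at e5
  change (if c.k = c.k then (1 : ℤ) else 0) - (if c.k = c.l then 1 else 0) =
    (if c.k = a.k then 1 else 0) - (if c.k = a.l then 1 else 0) +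
    ((if c.k = b.k then 1 else 0) - (if c.k = b.l then 1 else 0)) at e5
  rw [if_pos rfl, if_neg hc.ne, if_neg h1, if_neg h2] at e5
  split_ifs at e5 <;> omega

theorem isNormalOrder_specialGt (N h : ℕ) : IsNormalOrder (SpecialGt (N := N) h) where
  irrefl a ha := by
    have := a.k_lt_l
    unfold SpecialGt InA InB InC StdGt at ha
    omega
  trans a b c hab hbc := by
    have := a.k_lt_l
    have := b.k_lt_l
    have := c.k_lt_l
    unfold SpecialGt InA InB InC StdGt at *
    omega
  total a b hab := by
    rcases Std.Total.total (r := Weak (SpecialGt (N := N) h)) a b with h1 | h1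
    · exact Or.inl (h1.resolve_left hab)
    · exact Or.inr (h1.resolve_left (Ne.symm hab))
  between a b c habc := by
    have := a.k_lt_l
    have := b.k_lt_l
    have := c.k_lt_l
    rcases eq_of_vec_eq_add habc with ⟨h1, h2, h3⟩ | ⟨h1, h2, h3⟩
    -- The position of h relative to the ends of c and to the label where c splits decides in which
    -- of A_h, B_h, C_h the three roots lie.
    · rcases Nat.lt_or_ge h c.k with g1 | g1 <;> rcases Nat.lt_or_ge h c.l with g2 | g2 <;>
      rcases Nat.lt_or_ge h a.l with g3 | g3 <;>
      unfold SpecialGt InA InB InC StdGt <;> first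
        | (exfalso; omega)
        | (left; constructor <;> omega)
        | (right; constructor <;> omega)
    · rcases Nat.lt_or_ge h c.k with g1 | g1 <;> rcases Nat.lt_or_ge h c.l with g2 | g2 <;>
      rcases Nat.lt_or_ge h b.l with g3 | g3 <;>
      unfold SpecialGt InA InB InC StdGt <;> first
        | (exfalso; omega)
        | (left; constructor <;> omega)
        | (right; constructor <;> omega)

/-! ## Passing from `≻_{h+1}` to `≻_h` -/

/-- The number of the variable which is paired with `z_j` in the coefficients for `≻_h`: the
element of `{k, …, l - 1}` closest to `h`. -/
def pivot {N : ℕ} (h : ℕ) (a : PosRoot N) : ℕ :=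
  if h < a.k then a.k else if h < a.l then h else a.l - 1

section SpecialOrders

variable {N : ℕ} {R A : Type*} [CommRing R] [Ring A] [Algebra R A] [Module ℚ A]

theorem commute_exp {x y : A} (h : Commute x y) :
    Commute (IsNilpotent.exp x) (IsNilpotent.exp y) := by
  refine Commute.sum_left _ _ _ fun i _ => Commute.sum_right _ _ _ fun j _ => ?_
  exact ((h.pow_pow i j).smul_left _).smul_right _

omit [Module ℚ A] in
theorem isNilpotent_neg_smul {r : R} (hr : IsNilpotent r) (x : A) : IsNilpotent (-(r • x)) := by
  obtain ⟨k, hk⟩ := hr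
  refine IsNilpotent.neg ⟨k, ?_⟩
  rw [smul_pow, hk, zero_smul]

omit [Module ℚ A] in
theorem commute_neg_smul {x y : A} (h : Commute x y) (r s : R) :
    Commute (-(r • x)) (-(s • y)) :=
  (((h.smul_left r).smul_right s).neg_left).neg_right

/-- The ordered product of the exponentials `e^{-X_a E_a}`, where `E_a` satisfy the relations of
the `e_{l,k}` and `X_a` has its pole at `z_j` in the variable chosen by `pivot h`. -/
def expProd (h : ℕ) (E : PosRoot N → A) (X : ℕ → PosRoot N → R) : A :=
  orderedProd (SpecialGt h) Finset.univ fun a => IsNilpotent.exp (-(X (pivot h a) a • E a))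

omit [Module ℚ A] in
-- This is [K, L] = W_h - W_{h+1}. Only pairs of a root starting at h + 1 and a root ending there
-- occur, and each pair joins to exactly one root passing over h + 1. The relation `hXr` turns the
-- product of the two coefficients into a difference.
theorem sum_mul_sum_eq_of_relations (E : PosRoot N → A) (X : ℕ → PosRoot N → R)
    (hE : ∀ a b c : PosRoot N, a.k = b.l → c.k = b.k → c.l = a.l →
      E a * E b = E b * E a + E c)
    (hXr : ∀ (e : ℕ) (a b c : PosRoot N), c.k = a.k → c.l = e + 1 → b.k = e + 1 → b.l = a.l →
      X e a = X (e + 1) a - X e c * X (e + 1) b)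
    (h : ℕ) :
    (∑ a : PosRoot N with a.k = h + 1, -(X (h + 1) a • E a)) *
        (∑ a : PosRoot N with a.l = h + 1, -(X h a • E a)) =
      (∑ a : PosRoot N with a.l = h + 1, -(X h a • E a)) *
        (∑ a : PosRoot N with a.k = h + 1, -(X (h + 1) a • E a)) +
      ∑ a : PosRoot N with a.k ≤ h ∧ h + 1 < a.l, (-(X h a • E a) - -(X (h + 1) a • E a)) := by
  rw [Finset.sum_mul_sum, Finset.sum_mul_sum, Finset.sum_comm, ← sub_eq_iff_eq_add',
    ← Finset.sum_sub_distrib]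
  simp_rw [← Finset.sum_sub_distrib]
  rw [← Finset.sum_product']
  have hlt : ∀ p : PosRoot N × PosRoot N,
      p ∈ (Finset.univ.filter fun a : PosRoot N => a.l = h + 1) ×ˢ
        (Finset.univ.filter fun a : PosRoot N => a.k = h + 1) → p.1.1.1 < p.2.1.2 := by
    rintro ⟨c, b⟩ hp
    simp only [Finset.mem_product, Finset.mem_filter_univ] at hp
    have := c.k_lt_l
    have := b.k_lt_l
    change c.k < b.l
    omega
  have hN : ∀ a : PosRoot N, h + 1 < a.l → h + 1 < N := fun a ha => ha.trans a.1.2.isLt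
  -- A pair (c, b) meeting at h + 1 corresponds to its sum a; conversely, a is cut at h + 1.
  refine Finset.sum_bij'
    (fun p hp => (⟨(p.1.1.1, p.2.1.2), hlt p hp⟩ : PosRoot N))
    (fun a ha => ((⟨(a.1.1, ⟨h + 1, hN a (Finset.mem_filter.1 ha).2.2⟩),
        Nat.lt_succ_of_le (Finset.mem_filter.1 ha).2.1⟩ : PosRoot N),
      (⟨(⟨h + 1, hN a (Finset.mem_filter.1 ha).2.2⟩, a.1.2), (Finset.mem_filter.1 ha).2.2⟩ :
        PosRoot N)))
    ?_ ?_ ?_ ?_ ?_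
  · rintro ⟨c, b⟩ hp
    simp only [Finset.mem_product, Finset.mem_filter_univ] at hp ⊢
    have := c.k_lt_l
    have := b.k_lt_l
    change c.k ≤ h ∧ h + 1 < b.l
    omega
  · intro a ha
    simp only [Finset.mem_product, Finset.mem_filter_univ] at ha ⊢
    exact ⟨rfl, rfl⟩
  · rintro ⟨c, b⟩ hp
    simp only [Finset.mem_product, Finset.mem_filter_univ] at hp
    exact Prod.ext (PosRoot.ext_kl rfl hp.1.symm) (PosRoot.ext_kl hp.2.symm rfl)
  · intro a _
    exact PosRoot.ext_kl rfl rfl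
  · rintro ⟨c, b⟩ hp
    have hl := hlt _ hp
    simp only [Finset.mem_product, Finset.mem_filter_univ] at hp
    rw [hXr h ⟨(c.1.1, b.1.2), hl⟩ b c rfl hp.1 hp.2 rfl]
    have h2 := hE b c ⟨(c.1.1, b.1.2), hl⟩ (by rw [hp.1, hp.2]) rfl rfl
    simp only [neg_mul_neg, smul_mul_smul_comm]
    rw [h2, sub_smul, smul_add, mul_comm (X (h + 1) b)]
    abel

/-- Only the roots that start or end at h + 1 change class between the two orders, and only the
roots in W change their coefficient. Reordering e^K and e^L creates the commutator that accounts for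
the change on W. -/
theorem expProd_succ (E : PosRoot N → A) (X : ℕ → PosRoot N → R)
    (hX : ∀ e a, IsNilpotent (X e a))
    (hEc : ∀ a b : PosRoot N, a.k ≠ b.l → b.k ≠ a.l → Commute (E a) (E b))
    (hE : ∀ a b c : PosRoot N, a.k = b.l → c.k = b.k → c.l = a.l →
      E a * E b = E b * E a + E c)
    (hXr : ∀ (e : ℕ) (a b c : PosRoot N), c.k = a.k → c.l = e + 1 → b.k = e + 1 → b.l = a.l →
      X e a = X (e + 1) a - X e c * X (e + 1) b)
    (h : ℕ) : expProd (h + 1) E X = expProd h E X := by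
  set x : PosRoot N → A := fun a => -(X (pivot (h + 1) a) a • E a) with hxdef
  set y : PosRoot N → A := fun a => -(X (pivot h a) a • E a) with hydef
  have hx : ∀ a, IsNilpotent (x a) := fun a => isNilpotent_neg_smul (hX _ _) _
  have hy : ∀ a, IsNilpotent (y a) := fun a => isNilpotent_neg_smul (hX _ _) _
  have hxc : ∀ a b : PosRoot N, a.k ≠ b.l → b.k ≠ a.l → Commute (x a) (x b) :=
    fun a b h1 h2 => commute_neg_smul (hEc a b h1 h2) _ _
  have hyc : ∀ a b : PosRoot N, a.k ≠ b.l → b.k ≠ a.l → Commute (y a) (y b) :=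
    fun a b h1 h2 => commute_neg_smul (hEc a b h1 h2) _ _
  have hxyc : ∀ a b : PosRoot N, a.k ≠ b.l → b.k ≠ a.l → Commute (x a) (y b) :=
    fun a b h1 h2 => commute_neg_smul (hEc a b h1 h2) _ _
  -- The index nearest to h + 1 in {k, …, l - 1} differs from the one nearest to h only if both h
  -- and h + 1 lie in that interval.
  have hxy : ∀ a : PosRoot N, ¬ (a.k ≤ h ∧ h + 1 < a.l) → x a = y a := by
    intro a ha
    have := a.k_lt_l
    have : pivot (h + 1) a = pivot h a := by
      unfold pivot
      split_ifs <;> omega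
    simp only [hxdef, hydef, this]
  -- In these terms A_{h+1} = W ∪ K, B_{h+1} = L ∪ B, C_{h+1} = C, whereas A_h = W ∪ L, B_h = B, C_h
  -- = K ∪ C.
  let W : Finset (PosRoot N) := Finset.univ.filter fun a => a.k ≤ h ∧ h + 1 < a.l
  let K : Finset (PosRoot N) := Finset.univ.filter fun a => a.k = h + 1
  let L : Finset (PosRoot N) := Finset.univ.filter fun a => a.l = h + 1
  let B : Finset (PosRoot N) := Finset.univ.filter fun a => a.l ≤ h
  let C : Finset (PosRoot N) := Finset.univ.filter fun a => h + 1 < a.k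
  have mW : ∀ a, a ∈ W ↔ a.k ≤ h ∧ h + 1 < a.l := fun a => Finset.mem_filter_univ a
  have mK : ∀ a, a ∈ K ↔ a.k = h + 1 := fun a => Finset.mem_filter_univ a
  have mL : ∀ a, a ∈ L ↔ a.l = h + 1 := fun a => Finset.mem_filter_univ a
  have mB : ∀ a, a ∈ B ↔ a.l ≤ h := fun a => Finset.mem_filter_univ a
  have mC : ∀ a, a ∈ C ↔ h + 1 < a.k := fun a => Finset.mem_filter_univ a
  have nil_sum : ∀ (s : Finset (PosRoot N)) (f : PosRoot N → A), (∀ a, IsNilpotent (f a)) →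
      (∀ a ∈ s, ∀ b ∈ s, Commute (f a) (f b)) → IsNilpotent (∑ a ∈ s, f a) := by
    intro s f hf hc
    exact Commute.isNilpotent_sum (fun a _ => hf a) fun a b ha hb => hc a ha b hb
  have hdKW : Disjoint W K := Finset.disjoint_left.2 fun a h1 h2 => by
    rw [mW] at h1; rw [mK] at h2; omega
  have hdWL : Disjoint W L := Finset.disjoint_left.2 fun a h1 h2 => by
    rw [mW] at h1; rw [mL] at h2; omega
  -- the factors of the two ordered products
  have e1 : expProd (h + 1) E X = IsNilpotent.exp (∑ a ∈ W ∪ K, x a) *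
      (IsNilpotent.exp (∑ a ∈ L, x a) * (orderedProd (SpecialGt (h + 1)) B
        (fun a => IsNilpotent.exp (x a)) *
          orderedProd (SpecialGt (h + 1)) C (fun a => IsNilpotent.exp (x a)))) := by
    rw [← orderedProd_exp (SpecialGt (h + 1)) hx, ← orderedProd_exp (SpecialGt (h + 1)) hx,
      ← orderedProd_union (SpecialGt (h + 1)) (s := B ∪ C) rfl,
      ← orderedProd_union (SpecialGt (h + 1)) (s := L ∪ (B ∪ C)) rfl,
      ← orderedProd_union (SpecialGt (h + 1)) (s := Finset.univ)]
    · rfl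
    · refine Finset.eq_univ_iff_forall.2 fun a => ?_
      have := a.k_lt_l
      simp only [Finset.mem_union, mW, mK, mL, mB, mC]
      omega
    · refine Finset.disjoint_left.2 fun a => ?_
      simp only [Finset.mem_union, mW, mK, mL, mB, mC]
      have := a.k_lt_l
      omega
    · intro a ha b hb
      simp only [Finset.mem_union, mW, mK, mL, mB, mC] at ha hb
      have := a.k_lt_l
      have := b.k_lt_l
      unfold SpecialGt InA InB InC
      omega
    · refine Finset.disjoint_left.2 fun a => ?_
      simp only [Finset.mem_union, mL, mB, mC]
      have := a.k_lt_l
      omega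
    · intro a ha b hb
      simp only [Finset.mem_union, mL, mB, mC] at ha hb
      have := a.k_lt_l
      have := b.k_lt_l
      unfold SpecialGt InA InB InC StdGt
      omega
    · refine Finset.disjoint_left.2 fun a => ?_
      simp only [mB, mC]
      have := a.k_lt_l
      omega
    · intro a ha b hb
      simp only [mB, mC] at ha hb
      unfold SpecialGt InB InC
      omega
    · intro a ha b hb
      simp only [mL] at ha hb
      have := a.k_lt_l
      have := b.k_lt_l
      exact hxc a b (by omega) (by omega)
    · intro a ha b hb
      simp only [Finset.mem_union, mW, mK] at ha hb
      have := a.k_lt_l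
      have := b.k_lt_l
      exact hxc a b (by omega) (by omega)
  have e2 : expProd h E X = IsNilpotent.exp (∑ a ∈ W ∪ L, y a) *
      (orderedProd (SpecialGt h) B (fun a => IsNilpotent.exp (y a)) *
        (IsNilpotent.exp (∑ a ∈ K, y a) *
          orderedProd (SpecialGt h) C (fun a => IsNilpotent.exp (y a)))) := by
    rw [← orderedProd_exp (SpecialGt h) hy, ← orderedProd_exp (SpecialGt h) hy,
      ← orderedProd_union (SpecialGt h) (s := K ∪ C) rfl,
      ← orderedProd_union (SpecialGt h) (s := B ∪ (K ∪ C)) rfl,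
      ← orderedProd_union (SpecialGt h) (s := Finset.univ)]
    · rfl
    · refine Finset.eq_univ_iff_forall.2 fun a => ?_
      have := a.k_lt_l
      simp only [Finset.mem_union, mW, mK, mL, mB, mC]
      omega
    · refine Finset.disjoint_left.2 fun a => ?_
      simp only [Finset.mem_union, mW, mK, mL, mB, mC]
      have := a.k_lt_l
      omega
    · intro a ha b hb
      simp only [Finset.mem_union, mW, mK, mL, mB, mC] at ha hb
      have := a.k_lt_l
      have := b.k_lt_l
      unfold SpecialGt InA InB InC
      omega
    · refine Finset.disjoint_left.2 fun a => ?_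
      simp only [Finset.mem_union, mK, mB, mC]
      have := a.k_lt_l
      omega
    · intro a ha b hb
      simp only [Finset.mem_union, mK, mB, mC] at ha hb
      unfold SpecialGt InB InC
      omega
    · refine Finset.disjoint_left.2 fun a => ?_
      simp only [mK, mC]
      omega
    · intro a ha b hb
      simp only [mK, mC] at ha hb
      unfold SpecialGt InC
      omega
    · intro a ha b hb
      simp only [mK] at ha hb
      have := a.k_lt_l
      have := b.k_lt_l
      exact hyc a b (by omega) (by omega)
    · intro a ha b hb
      simp only [Finset.mem_union, mW, mL] at ha hb
      have := a.k_lt_l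
      have := b.k_lt_l
      exact hyc a b (by omega) (by omega)
  -- comparison of the factors
  have hB : orderedProd (SpecialGt (h + 1)) B (fun a => IsNilpotent.exp (x a)) =
      orderedProd (SpecialGt h) B (fun a => IsNilpotent.exp (y a)) := by
    refine orderedProd_congr _ (fun a ha b hb hab => ?_) fun a ha => ?_
    · simp only [mB] at ha hb
      have := a.k_lt_l
      have := b.k_lt_l
      unfold SpecialGt InA InB InC StdGt at *
      omega
    · simp only [mB] at ha
      simp only [hxy a (by omega)]
  have hC : orderedProd (SpecialGt (h + 1)) C (fun a => IsNilpotent.exp (x a)) =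
      orderedProd (SpecialGt h) C (fun a => IsNilpotent.exp (y a)) := by
    refine orderedProd_congr _ (fun a ha b hb hab => ?_) fun a ha => ?_
    · simp only [mC] at ha hb
      have := a.k_lt_l
      have := b.k_lt_l
      unfold SpecialGt InA InB InC StdGt at *
      omega
    · simp only [mC] at ha
      simp only [hxy a (by omega)]
  have hK : ∑ a ∈ K, x a = ∑ a ∈ K, y a := Finset.sum_congr rfl fun a ha => by
    rw [mK] at ha
    exact hxy a (by omega)
  have hL : ∑ a ∈ L, x a = ∑ a ∈ L, y a := Finset.sum_congr rfl fun a ha => by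
    rw [mL] at ha
    exact hxy a (by omega)
  have cWW : ∀ a ∈ W, ∀ b ∈ W, Commute (x a) (x b) := by
    intro a ha b hb
    rw [mW] at ha hb
    exact hxc a b (by omega) (by omega)
  have cWW' : ∀ a ∈ W, ∀ b ∈ W, Commute (x a) (y b - x b) := by
    intro a ha b hb
    refine Commute.sub_right ?_ (cWW a ha b hb)
    rw [mW] at ha hb
    exact hxyc a b (by omega) (by omega)
  have cKW : ∀ a ∈ K, ∀ b ∈ W, Commute (x a) (x b) ∧ Commute (x a) (y b - x b) := by
    intro a ha b hb
    rw [mK] at ha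
    rw [mW] at hb
    have := a.k_lt_l
    have h1 := hxc a b (by omega) (by omega)
    exact ⟨h1, (hxyc a b (by omega) (by omega)).sub_right h1⟩
  have cLW : ∀ a ∈ L, ∀ b ∈ W, Commute (x a) (y b - x b) ∧ Commute (x a) (y b) := by
    intro a ha b hb
    rw [mL] at ha
    rw [mW] at hb
    have := a.k_lt_l
    have h1 := hxyc a b (by omega) (by omega)
    exact ⟨h1.sub_right (hxc a b (by omega) (by omega)), h1⟩
  have nil_K : IsNilpotent (∑ a ∈ K, x a) := nil_sum K x hx fun a ha b hb => by
    rw [mK] at ha hb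
    have := a.k_lt_l
    have := b.k_lt_l
    exact hxc a b (by omega) (by omega)
  have nil_L : IsNilpotent (∑ a ∈ L, x a) := nil_sum L x hx fun a ha b hb => by
    rw [mL] at ha hb
    have := a.k_lt_l
    have := b.k_lt_l
    exact hxc a b (by omega) (by omega)
  have nil_W : IsNilpotent (∑ a ∈ W, x a) := nil_sum W x hx cWW
  have nil_Wy : IsNilpotent (∑ a ∈ W, y a) := nil_sum W y hy fun a ha b hb => by
    rw [mW] at ha hb
    exact hyc a b (by omega) (by omega)
  have nil_Z : IsNilpotent (∑ a ∈ W, (y a - x a)) := by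
    refine nil_sum W _ (fun a => (commute_neg_smul (Commute.refl (E a)) _ _).isNilpotent_sub
      (hy a) (hx a)) fun a ha b hb => ?_
    refine Commute.sub_left ?_ (cWW' a ha b hb)
    rw [mW] at ha hb
    exact (hyc a b (by omega) (by omega)).sub_right (hxyc b a (by omega) (by omega)).symm
  have comm_sums : ∀ (s t : Finset (PosRoot N)) (f g : PosRoot N → A),
      (∀ a ∈ s, ∀ b ∈ t, Commute (f a) (g b)) → Commute (∑ a ∈ s, f a) (∑ b ∈ t, g b) :=
    fun s t f g hfg => Commute.sum_left _ _ _ fun a ha => Commute.sum_right _ _ _ (hfg a ha)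
  have key : (∑ a ∈ K, x a) * (∑ a ∈ L, x a) =
      (∑ a ∈ L, x a) * (∑ a ∈ K, x a) + ∑ a ∈ W, (y a - x a) := by
    have hKx : ∑ a ∈ K, x a = ∑ a ∈ K, -(X (h + 1) a • E a) :=
      Finset.sum_congr rfl fun a ha => by
        rw [mK] at ha
        have := a.k_lt_l
        have : pivot (h + 1) a = h + 1 := by unfold pivot; split_ifs <;> omega
        simp only [hxdef, this]
    have hLx : ∑ a ∈ L, x a = ∑ a ∈ L, -(X h a • E a) :=
      Finset.sum_congr rfl fun a ha => by
        rw [mL] at ha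
        have := a.k_lt_l
        have : pivot (h + 1) a = h := by unfold pivot; split_ifs <;> omega
        simp only [hxdef, this]
    have hWx : ∑ a ∈ W, (y a - x a) = ∑ a ∈ W, (-(X h a • E a) - -(X (h + 1) a • E a)) :=
      Finset.sum_congr rfl fun a ha => by
        rw [mW] at ha
        have h1 : pivot (h + 1) a = h + 1 := by unfold pivot; split_ifs <;> omega
        have h2 : pivot h a = h := by unfold pivot; split_ifs <;> omega
        simp only [hxdef, hydef, h1, h2]
    rw [hKx, hLx, hWx]
    exact sum_mul_sum_eq_of_relations E X hE hXr h
  -- Roots of K start at h + 1 and roots of B end at or before h, so they share no label; hence e^K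
  -- can be moved past the B factors to stand next to e^L.
  have hcomm : Commute (IsNilpotent.exp (∑ a ∈ K, y a))
      (orderedProd (SpecialGt h) B (fun a => IsNilpotent.exp (y a))) := by
    refine orderedProd_commute _ fun b hb => commute_exp (Commute.sum_left _ _ _ fun a ha => ?_)
    rw [mK] at ha
    rw [mB] at hb
    have := a.k_lt_l
    have := b.k_lt_l
    exact hyc a b (by omega) (by omega)
  have hW : ∑ a ∈ W, y a = ∑ a ∈ W, x a + ∑ a ∈ W, (y a - x a) := by
    rw [← Finset.sum_add_distrib]
    exact Finset.sum_congr rfl fun a _ => by abel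
  rw [e1, e2, hB, hC, Finset.sum_union hdKW, Finset.sum_union hdWL,
    IsNilpotent.exp_add_of_commute
      (comm_sums W K x x fun a ha b hb => (cKW b hb a ha).1.symm) nil_W nil_K,
    IsNilpotent.exp_add_of_commute (comm_sums W L y y fun a ha b hb => by
      rw [← hxy b (by rw [mL] at hb; omega)]
      exact (cLW b hb a ha).2.symm) nil_Wy (hL ▸ nil_L),
    ← mul_assoc (orderedProd (SpecialGt h) B _), ← hcomm.eq, hW,
    IsNilpotent.exp_add_of_commute (comm_sums W W x _ cWW') nil_W nil_Z]
  have h3 := exp_mul_exp_of_central nil_K nil_L nil_Z key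
    (comm_sums K W _ _ fun a ha b hb => (cKW a ha b hb).2)
    (comm_sums L W _ _ fun a ha b hb => (cLW a ha b hb).1)
  rw [← hK, ← hL]
  simp only [mul_assoc] at h3 ⊢
  rw [← mul_assoc (IsNilpotent.exp (∑ a ∈ K, x a)) (IsNilpotent.exp (∑ a ∈ L, x a)), h3]
  simp only [mul_assoc]

/-- The ordered products for all the special orders agree with the one for the standard order. -/
theorem expProd_eq_standard (E : PosRoot N → A) (X : ℕ → PosRoot N → R)
    (hX : ∀ e a, IsNilpotent (X e a))
    (hEc : ∀ a b : PosRoot N, a.k ≠ b.l → b.k ≠ a.l → Commute (E a) (E b))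
    (hE : ∀ a b c : PosRoot N, a.k = b.l → c.k = b.k → c.l = a.l →
      E a * E b = E b * E a + E c)
    (hXr : ∀ (e : ℕ) (a b c : PosRoot N), c.k = a.k → c.l = e + 1 → b.k = e + 1 → b.l = a.l →
      X e a = X (e + 1) a - X e c * X (e + 1) b)
    (h : ℕ) : expProd h E X =
      orderedProd StdGt Finset.univ fun a => IsNilpotent.exp (-(X (a.l - 1) a • E a)) := by
  have h1 : ∀ d, expProd (h + d) E X = expProd h E X := by
    intro d
    induction d with
    | zero => rfl
    | succ d ih => rw [← ih, ← expProd_succ E X hX hEc hE hXr (h + d), add_assoc]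
  -- At level h + N every root satisfies l ≤ h + N, so only the class B is left; it carries the
  -- standard order, and the pivot is l - 1.
  rw [← h1 N]
  refine orderedProd_congr _ (fun a _ b _ hab => ?_) fun a _ => ?_
  · have ha : a.l < N := a.1.2.isLt
    have hb : b.l < N := b.1.2.isLt
    have := a.k_lt_l
    have := b.k_lt_l
    unfold SpecialGt InA InB InC StdGt at *
    omega
  · have ha : a.l < N := a.1.2.isLt
    have := a.k_lt_l
    have : pivot (h + N) a = a.l - 1 := by unfold pivot; split_ifs <;> omega
    rw [this]

end SpecialOrders

/-! ## The algebra generated by commuting elements of square zero -/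

section SquareZero

variable {T : Type*} [Fintype T]

/-- The commutative algebra generated by elements `ε_x`, `x ∈ T`, with `ε_x ^ 2 = 0`. -/
abbrev SqZero (T : Type*) : Type _ :=
  MvPolynomial T ℂ ⧸ Ideal.span ((fun s => MvPolynomial.monomial s (1 : ℂ)) ''
    Set.range fun x : T => Finsupp.single x 2)

/-- The generator `ε_x`. -/
def SqZero.eps (x : T) : SqZero T := Ideal.Quotient.mk _ (MvPolynomial.X x)

omit [Fintype T] in
theorem SqZero.isNilpotent_eps (x : T) : IsNilpotent (SqZero.eps x) := by
  refine ⟨2, ?_⟩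
  rw [SqZero.eps, ← map_pow, Ideal.Quotient.eq_zero_iff_mem, MvPolynomial.X_pow_eq_monomial]
  exact Ideal.subset_span ⟨_, ⟨x, rfl⟩, rfl⟩

/-- The coefficient of `∏_{x ∈ T} ε_x`. -/
def SqZero.topCoeff (T : Type*) [Fintype T] : SqZero T →ₗ[ℂ] ℂ :=
  Submodule.liftQ ((Ideal.span ((fun s => MvPolynomial.monomial s (1 : ℂ)) ''
    Set.range fun x : T => Finsupp.single x 2)).restrictScalars ℂ)
    (MvPolynomial.lcoeff ℂ (Finsupp.equivFunOnFinite.symm fun _ : T => 1)) (by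
      -- The functional vanishes on the ideal: each monomial there is divisible by some square,
      -- while the monomial read off has all exponents 1.
      intro q hq
      rw [Submodule.restrictScalars_mem, MvPolynomial.mem_ideal_span_monomial_image] at hq
      rw [LinearMap.mem_ker, MvPolynomial.lcoeff_apply]
      by_contra hne
      obtain ⟨_, ⟨x, rfl⟩, hx⟩ := hq _ (MvPolynomial.mem_support_iff.2 hne)
      have := hx x
      simp at this)

theorem SqZero.topCoeff_mk (q : MvPolynomial T ℂ) :
    SqZero.topCoeff T (Ideal.Quotient.mk _ q) =
      q.coeff (Finsupp.equivFunOnFinite.symm fun _ : T => 1) := rfl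

/-- The exponent of a generator is the size of the fibre of x over it, and all fibres have one
element exactly when x is bijective. -/
theorem SqZero.topCoeff_prod_eps {ι : Type*} [Fintype ι] (x : ι → T)
    [Decidable (Function.Bijective x)] :
    SqZero.topCoeff T (∏ i, SqZero.eps (x i)) = if Function.Bijective x then 1 else 0 := by
  classical
  simp only [SqZero.eps]
  rw [← map_prod, SqZero.topCoeff_mk]
  have h1 : ∏ i, MvPolynomial.X (R := ℂ) (x i) =
      MvPolynomial.monomial (∑ i, Finsupp.single (x i) 1) 1 :=
    (MvPolynomial.monomial_sum_one _ _).symm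
  rw [h1, MvPolynomial.coeff_monomial]
  refine if_congr ?_ rfl rfl
  rw [Function.bijective_iff_existsUnique, Finsupp.ext_iff]
  refine forall_congr' fun y => ?_
  simp only [Finsupp.equivFunOnFinite_symm_apply_apply, Finsupp.coe_finsetSum, Finset.sum_apply,
    Finsupp.single_apply]
  rw [Finset.sum_boole, Nat.cast_id, Finset.card_eq_one]
  constructor
  · rintro ⟨i, hi⟩
    refine ⟨i, (Finset.mem_filter_univ i).1 (hi ▸ Finset.mem_singleton_self i), fun j hj => ?_⟩
    exact Finset.mem_singleton.1 (hi ▸ (Finset.mem_filter_univ j).2 hj)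
  · rintro ⟨i, hi, hu⟩
    refine ⟨i, Finset.ext fun j => ?_⟩
    rw [Finset.mem_filter_univ, Finset.mem_singleton]
    exact ⟨hu j, fun h => h ▸ hi⟩

end SquareZero

/-! ## Generating functions of the coefficients -/

section Generating

variable {N : ℕ} {m : Fin (N - 1) → ℕ}

/-- A choice of one variable `t_p^{(d)}` for every simple root `p` in `a`. -/
abbrev Choice (m : Fin (N - 1) → ℕ) (a : PosRoot N) : Type :=
  ∀ p : {p : Fin (N - 1) // a.Contains p}, Fin (m p)

/-- The values of the chosen variables. -/
def Choice.val (t : Pt N m) {a : PosRoot N} (d : Choice m a) (p : ℕ) : ℂ :=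
  if hp : a.Contains p then
    t ⟨p, PosRoot.lt_of_contains hp⟩ (d ⟨⟨p, PosRoot.lt_of_contains hp⟩, hp⟩)
  else 0

/-- The function `∏_{p = k}^{l-2} 1 / (τ_p - τ_{p+1}) · 1 / (τ_e - ζ)`. -/
def weight (ζ : ℂ) (e : ℕ) (a : PosRoot N) (τ : ℕ → ℂ) : ℂ :=
  (∏ p ∈ Finset.Ico a.k (a.l - 1), 1 / (τ p - τ (p + 1))) * (1 / (τ e - ζ))

/-- The product of the generators that correspond to the chosen variables. -/
def Choice.mon {a : PosRoot N} (d : Choice m a) : SqZero (Σ p : Fin (N - 1), Fin (m p)) :=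
  ∏ p : {p : Fin (N - 1) // a.Contains p}, SqZero.eps ⟨p.1, d p⟩

/-- The sum over all choices of variables of the value of `weight`, multiplied by the generators. -/
def gen (ζ : ℂ) (t : Pt N m) (e : ℕ) (a : PosRoot N) : SqZero (Σ p : Fin (N - 1), Fin (m p)) :=
  ∑ d : Choice m a, weight ζ e a (d.val t) • d.mon

theorem isNilpotent_gen (ζ : ℂ) (t : Pt N m) (e : ℕ) (a : PosRoot N) :
    IsNilpotent (gen ζ t e a) := by
  have hk : a.Contains a.k := And.intro le_rfl a.k_lt_l
  refine isNilpotent_sum fun d _ => ?_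
  refine IsNilpotent.smul ?_ _
  rw [Choice.mon, ← Finset.mul_prod_erase Finset.univ _
    (Finset.mem_univ ⟨⟨a.k, PosRoot.lt_of_contains hk⟩, hk⟩)]
  exact (Commute.all _ _).isNilpotent_mul_right (SqZero.isNilpotent_eps _)

theorem prod_subtype_eq_prod_dite {ι M : Type*} [Fintype ι] [CommMonoid M] (q : ι → Prop)
    [DecidablePred q] (f : {i // q i} → M) :
    ∏ i, f i = ∏ i, if hi : q i then f ⟨i, hi⟩ else 1 := by
  rw [← Finset.prod_filter_mul_prod_filter_not Finset.univ q,
    Finset.prod_eq_one (s := Finset.univ.filter fun i => ¬ q i)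
      fun i hi => dif_neg (Finset.mem_filter.1 hi).2, mul_one,
    Finset.prod_subtype (Finset.univ.filter q) (p := q) fun i => Finset.mem_filter_univ i]
  refine Finset.prod_congr rfl fun i _ => ?_
  rw [dif_pos i.2]

theorem weight_congr {ζ : ℂ} {e : ℕ} {a : PosRoot N} {τ τ' : ℕ → ℂ} (he : a.Contains e)
    (h : ∀ p, a.Contains p → τ p = τ' p) : weight ζ e a τ = weight ζ e a τ' := by
  rw [weight, weight, h e he]
  congr 1
  refine Finset.prod_congr rfl fun p hp => ?_
  rw [Finset.mem_Ico] at hp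
  rw [h p ⟨hp.1, by omega⟩, h (p + 1) ⟨by omega, by omega⟩]

/-- After cutting the chain between e and e + 1, this is the partial fraction identity 1/(τ_{e+1} -
ζ) - 1/(τ_e - ζ) = (τ_e - τ_{e+1}) / ((τ_e - ζ)(τ_{e+1} - ζ)). -/
theorem weight_sub_weight {ζ : ℂ} {e : ℕ} {a b c : PosRoot N} (h1 : c.k = a.k) (h2 : c.l = e + 1)
    (h3 : b.k = e + 1) (h4 : b.l = a.l) {τ : ℕ → ℂ} (he : τ e ≠ ζ) (he' : τ (e + 1) ≠ ζ)
    (hee : τ e ≠ τ (e + 1)) :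
    weight ζ e a τ = weight ζ (e + 1) a τ - weight ζ e c τ * weight ζ (e + 1) b τ := by
  have hb := b.k_lt_l
  have hc := c.k_lt_l
  have hsplit : ∏ p ∈ Finset.Ico a.k (a.l - 1), 1 / (τ p - τ (p + 1)) =
      (∏ p ∈ Finset.Ico c.k (c.l - 1), 1 / (τ p - τ (p + 1))) * (1 / (τ e - τ (e + 1))) *
        ∏ p ∈ Finset.Ico b.k (b.l - 1), 1 / (τ p - τ (p + 1)) := by
    rw [h1, h2, h3, h4, Nat.add_sub_cancel, ← Finset.prod_Ico_succ_top (by omega),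
      Finset.prod_Ico_consecutive _ (by omega) (by omega)]
  rw [weight, weight, weight, weight, hsplit]
  have g1 := sub_ne_zero.2 he
  have g2 := sub_ne_zero.2 he'
  have g3 := sub_ne_zero.2 hee
  generalize ∏ p ∈ Finset.Ico c.k (c.l - 1), 1 / (τ p - τ (p + 1)) = x
  generalize ∏ p ∈ Finset.Ico b.k (b.l - 1), 1 / (τ p - τ (p + 1)) = y
  field_simp
  ring

/-- Choices for `α + β` are pairs of choices for `α` and for `β`. -/
def Choice.splitEquiv {e : ℕ} {a b c : PosRoot N} (h1 : c.k = a.k) (h2 : c.l = e + 1)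
    (h3 : b.k = e + 1) (h4 : b.l = a.l) : Choice m a ≃ Choice m c × Choice m b where
  toFun d := (fun p => d ⟨p.1, by
      have := b.k_lt_l
      have h5 := p.2.1
      have h6 := p.2.2
      exact ⟨by omega, by omega⟩⟩,
    fun p => d ⟨p.1, by
      have := c.k_lt_l
      have h5 := p.2.1
      have h6 := p.2.2
      exact ⟨by omega, by omega⟩⟩)
  invFun d p := if hp : c.Contains p.1 then d.1 ⟨p.1, hp⟩ else d.2 ⟨p.1, by
      have h5 := p.2.1
      have h6 := p.2.2
      unfold PosRoot.Contains at hp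
      exact ⟨by omega, by omega⟩⟩
  left_inv d := by
    funext p
    dsimp only
    split_ifs <;> rfl
  right_inv d := by
    refine Prod.ext (funext fun p => dif_pos p.2) (funext fun p => dif_neg fun hp => ?_)
    have h5 : b.k ≤ (p.1 : ℕ) := p.2.1
    have h6 : (p.1 : ℕ) < c.l := hp.2
    omega

/-- The simple roots in a are the disjoint union of those in c and in b, so the product of two
generating functions is again a sum over choices for a, with the same monomials in ε. The relation
then holds term by term. -/
theorem gen_relation {ζ : ℂ} {t : Pt N m} (hz : ∀ p d, t p d ≠ ζ)
    (ht : ∀ p q : Fin (N - 1), (q : ℕ) = p + 1 → ∀ d d', t p d ≠ t q d')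
    (e : ℕ) (a b c : PosRoot N) (h1 : c.k = a.k) (h2 : c.l = e + 1)
    (h3 : b.k = e + 1) (h4 : b.l = a.l) :
    gen ζ t e a = gen ζ t (e + 1) a - gen ζ t e c * gen ζ t (e + 1) b := by
  have hb := b.k_lt_l
  have hc := c.k_lt_l
  have ce : c.Contains e := And.intro (by omega) (by omega)
  have be : b.Contains (e + 1) := And.intro (by omega) (by omega)
  have ae : a.Contains e := And.intro (by omega) (by omega)
  have ae' : a.Contains (e + 1) := And.intro (by omega) (by omega)
  have hca : ∀ p, c.Contains p → a.Contains p := fun p hp => by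
    unfold PosRoot.Contains at *
    omega
  have hba : ∀ p, b.Contains p → a.Contains p := fun p hp => by
    unfold PosRoot.Contains at *
    omega
  have hmul : gen ζ t e c * gen ζ t (e + 1) b =
      ∑ d : Choice m a, (weight ζ e c (d.val t) * weight ζ (e + 1) b (d.val t)) • d.mon := by
    rw [gen, gen, Finset.sum_mul_sum, ← Fintype.sum_prod_type',
      ← (Choice.splitEquiv h1 h2 h3 h4).sum_comp]
    refine Finset.sum_congr rfl fun d _ => ?_
    rw [smul_mul_smul_comm]
    congr 1
    · congr 1
      · refine weight_congr ce fun p hp => ?_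
        rw [Choice.val, Choice.val, dif_pos hp, dif_pos (hca p hp)]
        rfl
      · refine weight_congr be fun p hp => ?_
        rw [Choice.val, Choice.val, dif_pos hp, dif_pos (hba p hp)]
        rfl
    · rw [Choice.mon, Choice.mon, Choice.mon, prod_subtype_eq_prod_dite, prod_subtype_eq_prod_dite,
        prod_subtype_eq_prod_dite, ← Finset.prod_mul_distrib]
      refine Finset.prod_congr rfl fun p _ => ?_
      by_cases hcp : c.Contains p
      · have hbp : ¬ b.Contains p := by
          unfold PosRoot.Contains at *
          omega
        rw [dif_pos hcp, dif_neg hbp, dif_pos (hca p hcp), mul_one]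
        rfl
      · by_cases hbp : b.Contains p
        · rw [dif_neg hcp, dif_pos hbp, dif_pos (hba p hbp), one_mul]
          rfl
        · have hap : ¬ a.Contains p := by
            unfold PosRoot.Contains at *
            omega
          rw [dif_neg hcp, dif_neg hbp, dif_neg hap, one_mul]
  rw [hmul, gen, gen, ← Finset.sum_sub_distrib]
  refine Finset.sum_congr rfl fun d _ => ?_
  rw [← sub_smul]
  congr 1
  refine weight_sub_weight h1 h2 h3 h4 ?_ ?_ ?_
  · rw [Choice.val, dif_pos ae]
    exact hz _ _
  · rw [Choice.val, dif_pos ae']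
    exact hz _ _
  · rw [Choice.val, Choice.val, dif_pos ae, dif_pos ae']
    exact ht _ _ rfl _ _

/-! ## The top coefficient of a product of generating functions -/

variable {n : ℕ}

/-- Choices for all `s ∈ S(I)`, arranged by the simple roots. -/
def choicesEquiv (I : Idx N n) :
    (∀ s : S I, Choice m s.1.2) ≃ (∀ p : Fin (N - 1), SAt I p → Fin (m p)) where
  toFun D p s := D s.1 ⟨p, s.2⟩
  invFun D s p := D p.1 ⟨s, p.2⟩
  left_inv _ := rfl
  right_inv _ := rfl

/-- The choices D form one map from pairs (s, p) to variables that preserves p; it is bijective iff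
it is bijective for every p. -/
theorem topCoeff_prod_mon (I : Idx N n) (D : ∀ s : S I, Choice m s.1.2)
    [Decidable (∀ p, Function.Bijective (choicesEquiv I D p))] :
    SqZero.topCoeff _ (∏ s : S I, (D s).mon) =
      if ∀ p, Function.Bijective (choicesEquiv I D p) then 1 else 0 := by
  classical
  have h1 : ∏ s : S I, (D s).mon =
      ∏ x : Σ s : S I, {p : Fin (N - 1) // s.1.2.Contains p},
        SqZero.eps (⟨x.2.1, D x.1 x.2⟩ : Σ p : Fin (N - 1), Fin (m p)) :=
    (Fintype.prod_sigma fun x : Σ s : S I, {p : Fin (N - 1) // s.1.2.Contains p} =>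
      SqZero.eps (⟨x.2.1, D x.1 x.2⟩ : Σ p : Fin (N - 1), Fin (m p))).symm
  rw [h1, SqZero.topCoeff_prod_eps]
  refine if_congr ?_ rfl rfl
  let e : (Σ p : Fin (N - 1), SAt I p) ≃ Σ s : S I, {p : Fin (N - 1) // s.1.2.Contains p} :=
    { toFun := fun x => ⟨x.2.1, ⟨x.1, x.2.2⟩⟩
      invFun := fun x => ⟨x.2.1, ⟨x.1, x.2.2⟩⟩
      left_inv := fun _ => rfl
      right_inv := fun _ => rfl }
  rw [← e.bijective_comp]
  change Function.Bijective (Sigma.map (β₁ := fun p : Fin (N - 1) => SAt I p)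
    (β₂ := fun p => Fin (m p)) id fun p => choicesEquiv I D p) ↔ _
  constructor
  · rintro ⟨hi, hs⟩ p
    refine ⟨fun s s' h => ?_, fun d => ?_⟩
    · have h2 : (⟨p, s⟩ : Σ p : Fin (N - 1), SAt I p) = ⟨p, s'⟩ :=
        hi (Sigma.ext rfl (heq_of_eq h))
      exact eq_of_heq (Sigma.mk.inj h2).2
    · obtain ⟨⟨q, s⟩, hq⟩ := hs ⟨p, d⟩
      obtain ⟨h3, h4⟩ := Sigma.mk.inj hq
      obtain rfl : q = p := h3
      exact ⟨s, eq_of_heq h4⟩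
  · intro hD
    exact ⟨Function.injective_id.sigma_map fun p => (hD p).1,
      Function.surjective_id.sigma_map fun p => (hD p).2⟩

theorem prod_gen (I : Idx N n) (z : Fin n → ℂ) (t : Pt N m) (e : PosRoot N → ℕ) :
    ∏ s : S I, gen (z s.1.1) t (e s.1.2) s.1.2 =
      ∑ D : ∀ s : S I, Choice m s.1.2,
        (∏ s, weight (z s.1.1) (e s.1.2) s.1.2 ((D s).val t)) • ∏ s, (D s).mon := by
  simp only [gen]
  rw [Finset.prod_univ_sum, Fintype.piFinset_univ]
  exact Finset.sum_congr rfl fun D _ => Finset.prod_smul _ _ _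

theorem card_SAt (I : Idx N n) (p : ℕ) :
    Fintype.card (SAt I p) = ∑ j, ∑ a with a.Contains p, I j a := by
  rw [Fintype.card_subtype, Finset.card_filter, Fintype.sum_sigma, Fintype.sum_prod_type]
  refine Finset.sum_congr rfl fun j _ => ?_
  rw [Finset.sum_filter]
  refine Finset.sum_congr rfl fun a _ => ?_
  dsimp only
  split_ifs <;> simp

/-- Bijections from S_p(I) to the m_p variables force the cardinalities that define P(ν_0, n). -/
theorem topCoeff_prod_gen_of_notMem {I : Idx N n} (hI : I ∉ P N n m) (z : Fin n → ℂ) (t : Pt N m)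
    (e : PosRoot N → ℕ) :
    SqZero.topCoeff _ (∏ s : S I, gen (z s.1.1) t (e s.1.2) s.1.2) = 0 := by
  classical
  rw [prod_gen, map_sum]
  refine Finset.sum_eq_zero fun D _ => ?_
  rw [map_smul, topCoeff_prod_mon, if_neg, smul_zero]
  intro hD
  refine hI (mem_P.2 fun p => ?_)
  rw [← card_SAt, Fintype.card_congr (Equiv.ofBijective _ (hD p)), Fintype.card_fin]

theorem topCoeff_prod_gen (β : Labelling N n m) (I : P N n m) (z : Fin n → ℂ) (t : Pt N m)
    (e : PosRoot N → ℕ) :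
    SqZero.topCoeff _ (∏ s : S I.1, gen (z s.1.1) t (e s.1.2) s.1.2) =
      ∑ σ : ∀ p : Fin (N - 1), Equiv.Perm (Fin (m p)),
        ∏ s : S I.1, weight (z s.1.1) (e s.1.2) s.1.2
          (coord β I (fun p d => t p (σ p d)) s) := by
  classical
  rw [prod_gen, map_sum]
  simp_rw [map_smul, topCoeff_prod_mon, smul_ite, smul_zero, smul_eq_mul, mul_one]
  rw [← Finset.sum_filter]
  symm
  -- A family of bijections S_p(I) → {1, …, m_p} is uniquely σ_p ∘ β_p, which is why the labelling
  -- disappears after symmetrization.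
  refine Finset.sum_bij' (fun σ _ => (choicesEquiv I.1).symm fun p s => σ p (β I p s))
    (fun D hD p => (β I p).symm.trans (Equiv.ofBijective _ ((Finset.mem_filter.1 hD).2 p)))
    ?_ ?_ ?_ ?_ ?_
  · intro σ _
    rw [Finset.mem_filter_univ]
    intro p
    rw [Equiv.apply_symm_apply]
    exact ((β I p).trans (σ p)).bijective
  · exact fun _ _ => Finset.mem_univ _
  · intro σ _
    funext p
    ext d
    simp [choicesEquiv]
  · intro D hD
    rw [Equiv.symm_apply_eq]
    funext p s
    simp
  · intro σ _
    rfl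

end Generating

/-! ## Products over lists as multilinear maps -/

section ListProducts

/-- The product over a list that contains every element of `ι` once, as a multilinear map. -/
def listMul (R A : Type*) [CommSemiring R] [Semiring A] [Algebra R A] {ι : Type*} [DecidableEq ι]
    (l : List ι) (hn : l.Nodup) (hl : ∀ a, a ∈ l) : MultilinearMap R (fun _ : ι => A) A :=
  (MultilinearMap.mkPiAlgebraFin R l.length A).domDomCongr
    (List.Nodup.getEquivOfForallMemList l hn hl)

variable {R A : Type*} [CommSemiring R] [Semiring A] [Algebra R A] {ι : Type*} [DecidableEq ι]
    {l : List ι}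

theorem listMul_apply (hn : l.Nodup) (hl : ∀ a, a ∈ l) (x : ι → A) :
    listMul R A l hn hl x = (l.map x).prod := by
  have h : l.map x = List.ofFn fun i : Fin l.length => x (l.get i) := by
    conv_lhs => rw [← List.ofFn_get l, List.map_ofFn]
    rfl
  rw [h]
  rfl

theorem list_prod_map_sum [Fintype ι] (hn : l.Nodup) (hl : ∀ a, a ∈ l) {κ : Type*}
    (s : ι → Finset κ) (g : ι → κ → A) :
    (l.map fun a => ∑ q ∈ s a, g a q).prod =
      ∑ r ∈ Fintype.piFinset s, (l.map fun a => g a (r a)).prod := by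
  classical
  rw [← listMul_apply (R := ℕ) hn hl, MultilinearMap.map_sum_finset]
  exact Finset.sum_congr rfl fun r _ => listMul_apply hn hl _

theorem list_prod_map_smul [Fintype ι] (hn : l.Nodup) (hl : ∀ a, a ∈ l) (c : ι → R) (x : ι → A) :
    (l.map fun a => c a • x a).prod = (∏ a, c a) • (l.map x).prod := by
  rw [← listMul_apply (R := R) hn hl, MultilinearMap.map_smul_univ, listMul_apply]

end ListProducts

/-! ## Ordered exponentials as generating functions of the PBW monomials -/

section Expansion

variable {N : ℕ} (gt : PosRoot N → PosRoot N → Prop) [DecidableRel gt]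
    [IsTrans (PosRoot N) (Weak gt)] [Std.Antisymm (Weak gt)] [Std.Total (Weak gt)]
    {R A : Type*} [CommRing R] [Ring A] [Algebra R A] [Algebra ℂ A]
    [Module ℚ A]

/-- Expanding every truncated exponential and distributing yields one PBW monomial per exponent
vector; the factors 1/q! and (-1)^q of the series are those built into `pbwMonomial`. The
coefficients X lie in the commutative ring R and can be pulled out of the ordered product. -/
theorem orderedProd_exp_eq_sum (φ : UEA N →ₐ[ℂ] A) (F : PosRoot N → SL N) (X : PosRoot N → R)
    {M : ℕ} (hX : ∀ a, X a ^ M = 0) :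
    orderedProd gt Finset.univ (fun a =>
        IsNilpotent.exp (-(X a • φ (UniversalEnvelopingAlgebra.ι ℂ (F a))))) =
      ∑ i ∈ Fintype.piFinset fun _ => Finset.range M,
        (∏ a, X a ^ i a) • φ (pbwMonomial gt F i) := by
  have h1 : ∀ a, IsNilpotent.exp (-(X a • φ (UniversalEnvelopingAlgebra.ι ℂ (F a)))) =
      ∑ q ∈ Finset.range M, X a ^ q • ((-1 : ℂ) ^ q •
        φ (((Nat.factorial q : ℂ)⁻¹) • (UniversalEnvelopingAlgebra.ι ℂ (F a)) ^ q)) := by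
    intro a
    rw [IsNilpotent.exp_eq_sum (k := M) (by rw [neg_pow, smul_pow, hX, zero_smul, mul_zero])]
    refine Finset.sum_congr rfl fun q _ => ?_
    rw [← neg_one_smul ℂ (X a • φ _), smul_pow, smul_pow, map_smul, map_pow,
      ← Rat.cast_smul_eq_qsmul ℂ, smul_comm (X a ^ q), smul_comm (X a ^ q), smul_comm]
    simp
  have hn := Finset.sort_nodup (Finset.univ : Finset (PosRoot N)) (Weak gt)
  have hl : ∀ a, a ∈ (Finset.univ : Finset (PosRoot N)).sort (Weak gt) := fun a =>
    (Finset.mem_sort _).2 (Finset.mem_univ a)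
  simp only [orderedProd, h1]
  rw [list_prod_map_sum hn hl]
  refine Finset.sum_congr rfl fun i _ => ?_
  rw [list_prod_map_smul hn hl, list_prod_map_smul hn hl, pbwMonomial, map_smul, map_list_prod,
    List.map_map, Finset.prod_pow_eq_pow_sum]
  rfl

end Expansion

/-! ## The action on the tensor product -/

section TensorAction

variable {N n : ℕ} {V : Fin n → Type*} [∀ j, AddCommGroup (V j)] [∀ j, Module ℂ (V j)]
  [∀ j, LieRingModule (SL N) (V j)] [∀ j, LieModule ℂ (SL N) (V j)]

/-- The action of `U(sl_N)` on the `j`-th tensor factor. -/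
def factorAct (V : Fin n → Type*) [∀ j, AddCommGroup (V j)] [∀ j, Module ℂ (V j)]
    [∀ j, LieRingModule (SL N) (V j)] [∀ j, LieModule ℂ (SL N) (V j)] (j : Fin n) :
    UEA N →ₐ[ℂ] Module.End ℂ (⨂[ℂ] j, V j) :=
  AlgHom.ofLinearMap
    (((PiTensorProduct.mapMultilinear ℂ V V).toLinearMap 1 j) ∘ₗ
      (UniversalEnvelopingAlgebra.lift ℂ (LieModule.toEnd ℂ (SL N) (V j))).toLinearMap)
    (by
      change PiTensorProduct.mapMonoidHom (Pi.mulSingle j _) = 1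
      rw [AlgHom.toLinearMap_apply, map_one, Pi.mulSingle_one, map_one])
    (fun x y => by
      change PiTensorProduct.mapMonoidHom (Pi.mulSingle j _) =
        PiTensorProduct.mapMonoidHom (Pi.mulSingle j _) *
          PiTensorProduct.mapMonoidHom (Pi.mulSingle j _)
      rw [← map_mul, ← Pi.mulSingle_mul]
      simp only [AlgHom.toLinearMap_apply, map_mul])

/-- Endomorphisms supported on single tensor factors multiply componentwise, so their product over
all j is the tensor product of the individual actions. -/
theorem list_prod_factorAct (u : Fin n → UEA N) (v : ∀ j, V j) :
    ((List.finRange n).map fun j => factorAct V j (u j)).prod (PiTensorProduct.tprod ℂ v) =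
      PiTensorProduct.tprod ℂ fun j => act (u j) (v j) := by
  have h1 : ((List.finRange n).map fun j => factorAct V j (u j)).prod =
      PiTensorProduct.map fun j =>
        UniversalEnvelopingAlgebra.lift ℂ (LieModule.toEnd ℂ (SL N) (V j)) (u j) := by
    have h0 : ((List.finRange n).map fun j => factorAct V j (u j)) =
        ((List.finRange n).map fun j => Pi.mulSingle j
          (UniversalEnvelopingAlgebra.lift ℂ (LieModule.toEnd ℂ (SL N) (V j)) (u j))).map
            (PiTensorProduct.mapMonoidHom (R := ℂ) (s := V)) := by
      rw [List.map_map]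
      rfl
    rw [h0, ← map_list_prod]
    change PiTensorProduct.map _ = _
    congr 1
    have h2 := Finset.noncommProd_mulSingle (M := fun j => Module.End ℂ (V j)) (fun j =>
      UniversalEnvelopingAlgebra.lift ℂ (LieModule.toEnd ℂ (SL N) (V j)) (u j))
    rw [← h2, ← Finset.noncommProd_toFinset _ _ (fun i _ j _ hij => Pi.mulSingle_apply_commute
        (fun j => UniversalEnvelopingAlgebra.lift ℂ (LieModule.toEnd ℂ (SL N) (V j)) (u j)) i j)
      (List.nodup_finRange n)]
    exact Finset.noncommProd_congr (by simp) (fun _ _ => rfl) _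
  rw [h1, PiTensorProduct.map_tprod]
  rfl

variable (R : Type*) [CommRing R] [Algebra ℂ R]

/-- The action of `U(sl_N)` on the `j`-th tensor factor, after extension of scalars to `R`. -/
def scalarAct (V : Fin n → Type*) [∀ j, AddCommGroup (V j)] [∀ j, Module ℂ (V j)]
    [∀ j, LieRingModule (SL N) (V j)] [∀ j, LieModule ℂ (SL N) (V j)] (j : Fin n) :
    UEA N →ₐ[ℂ] Module.End R (R ⊗[ℂ] (⨂[ℂ] j, V j)) :=
  (Module.End.baseChangeHom ℂ R (⨂[ℂ] j, V j)).comp (factorAct V j)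

theorem list_prod_scalarAct (u : Fin n → UEA N) (v : ∀ j, V j) :
    ((List.finRange n).map fun j => scalarAct R V j (u j)).prod
        (1 ⊗ₜ[ℂ] PiTensorProduct.tprod ℂ v) =
      1 ⊗ₜ[ℂ] PiTensorProduct.tprod ℂ fun j => act (u j) (v j) := by
  have h1 : ((List.finRange n).map fun j => scalarAct R V j (u j)).prod =
      Module.End.baseChangeHom ℂ R (⨂[ℂ] j, V j)
        ((List.finRange n).map fun j => factorAct V j (u j)).prod := by
    rw [map_list_prod, List.map_map]
    rfl
  rw [h1]
  change LinearMap.baseChange R _ _ = _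
  rw [LinearMap.baseChange_tmul, list_prod_factorAct]

end TensorAction

/-! ## Symmetrized sums as top coefficients of products of ordered exponentials -/

section Symmetrization

variable {N n : ℕ} {m : Fin (N - 1) → ℕ} {V : Fin n → Type*} [∀ j, AddCommGroup (V j)]
  [∀ j, Module ℂ (V j)] [∀ j, LieRingModule (SL N) (V j)] [∀ j, LieModule ℂ (SL N) (V j)]

/-- The coefficient of the product of all generators, for vectors with coefficients in the
algebra of square zero generators. -/
def topProj (T W : Type*) [Fintype T] [AddCommGroup W] [Module ℂ W] :
    SqZero T ⊗[ℂ] W →ₗ[ℂ] W :=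
  TensorProduct.lid ℂ W ∘ₗ LinearMap.rTensor W (SqZero.topCoeff T)

theorem topProj_smul {T W : Type*} [Fintype T] [AddCommGroup W] [Module ℂ W] (r : SqZero T)
    (w : W) : topProj T W (r • ((1 : SqZero T) ⊗ₜ[ℂ] w)) = SqZero.topCoeff T r • w := by
  rw [TensorProduct.smul_tmul', smul_eq_mul, mul_one, topProj, LinearMap.comp_apply,
    LinearMap.rTensor_tmul]
  exact TensorProduct.lid_tmul _ _

/-- The scalars of the algebra in which the exponentials are formed. -/
abbrev Scalars (m : Fin (N - 1) → ℕ) : Type := SqZero (Σ p : Fin (N - 1), Fin (m p))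

theorem prod_pow_eq_prod_S {R : Type*} [CommMonoid R] (I : Idx N n) (f : Fin n → PosRoot N → R) :
    ∏ j, ∏ a, f j a ^ I j a = ∏ s : S I, f s.1.1 s.1.2 := by
  rw [Fintype.prod_sigma, Fintype.prod_prod_type]
  refine Finset.prod_congr rfl fun j _ => Finset.prod_congr rfl fun a _ => ?_
  change _ = ∏ _q : Fin (I j a), f j a
  rw [Finset.prod_const, Finset.card_univ, Fintype.card_fin]

/-- The bridge between rational functions and exponentials, for any order, root vectors F and pole
indices e. Both sides of the theorem are instances of it. -/
theorem symmetrize_eq_topProj (gt : PosRoot N → PosRoot N → Prop) [DecidableRel gt]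
    [IsTrans (PosRoot N) (Weak gt)] [Std.Antisymm (Weak gt)] [Std.Total (Weak gt)]
    [Module ℚ (Module.End (Scalars m) (Scalars m ⊗[ℂ] (⨂[ℂ] j, V j)))]
    (F : PosRoot N → SL N) (e : PosRoot N → ℕ) (β : Labelling N n m) (v : ∀ j, V j)
    (z : Fin n → ℂ) (t : Pt N m) :
    symmetrize (fun t => ∑ I : P N n m,
        (∏ s : S I.1, weight (z s.1.1) (e s.1.2) s.1.2 (coord β I t s)) •
          PiTensorProduct.tprod ℂ fun j => act (pbwMonomial gt F (I.1 j)) (v j)) t =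
      topProj _ _ (((List.finRange n).map fun j => orderedProd gt Finset.univ fun a =>
        IsNilpotent.exp (-(gen (z j) t (e a) a •
          scalarAct (Scalars m) V j (UniversalEnvelopingAlgebra.ι ℂ (F a))))).prod
        (1 ⊗ₜ[ℂ] PiTensorProduct.tprod ℂ v)) := by
  classical
  have hnil : ∀ x : Fin n × PosRoot N, ∃ k, gen (z x.1) t (e x.2) x.2 ^ k = 0 :=
    fun x => isNilpotent_gen _ _ _ _
  choose k hk using hnil
  -- One bound serves two purposes: it kills the M-th power of every generating function, and the
  -- box of exponents below M contains P(ν_0, n).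
  set M := ∑ x, k x + (∑ p, m p + 1) with hM
  have hpow : ∀ j a, gen (z j) t (e a) a ^ M = 0 := fun j a =>
    pow_eq_zero_of_le ((single_le_sum_nat k (j, a)).trans (Nat.le_add_right _ _)) (hk (j, a))
  simp only [orderedProd_exp_eq_sum gt _ F _ (hpow _)]
  rw [list_prod_map_sum (List.nodup_finRange n) List.mem_finRange]
  simp only [list_prod_map_smul (List.nodup_finRange n) List.mem_finRange]
  rw [LinearMap.sum_apply, map_sum]
  simp only [LinearMap.smul_apply, list_prod_scalarAct, topProj_smul]
  simp only [fun I : Idx N n => prod_pow_eq_prod_S I fun j a => gen (z j) t (e a) a]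
  have hsub : P N n m ⊆ Fintype.piFinset fun _ => Fintype.piFinset fun _ => Finset.range M := by
    intro I hI
    have h1 := (Finset.mem_filter.1 hI).1
    rw [Fintype.mem_piFinset] at h1 ⊢
    intro j
    have h2 := h1 j
    rw [Fintype.mem_piFinset] at h2 ⊢
    intro a
    have h3 := h2 a
    rw [Finset.mem_range] at h3 ⊢
    exact h3.trans_le (Nat.le_add_left _ _)
  rw [← Finset.sum_subset hsub fun I _ hI => by rw [topCoeff_prod_gen_of_notMem hI, zero_smul],
    ← Finset.sum_coe_sort (P N n m), symmetrize, Finset.sum_comm]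
  refine Finset.sum_congr rfl fun I _ => ?_
  rw [topCoeff_prod_gen β, Finset.sum_smul]

end Symmetrization

/-! ## Removing the signs -/

section Signs

variable {N n : ℕ} {m : Fin (N - 1) → ℕ}

/-- If k ≤ h < l, then p > h puts α_{k,p} in A_h and α_{p,l} in C_h, which counts, while p ≤ h puts
them in B_h and A_h, which does not. Inside C_h every p counts, inside B_h none. The result is the
exponent of -1 in φ_h. -/
theorem flips_eq (h : ℕ) (a : PosRoot N) :
    flips h a = if h < a.k then a.l - 1 - a.k else if h < a.l then a.l - 1 - h else 0 := by
  have hb : ∀ p : Fin N, (∃ (h1 : a.1.1 < p) (h2 : p < a.1.2),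
      SpecialGt h (⟨(a.1.1, p), h1⟩ : PosRoot N) (⟨(p, a.1.2), h2⟩ : PosRoot N)) ↔
      (p : ℕ) ∈ Finset.Ioo (max a.k (min h a.l)) a.l := by
    intro p
    have hal := a.k_lt_l
    rw [Finset.mem_Ioo, max_lt_iff]
    constructor
    · rintro ⟨h1, h2, h3⟩
      have h1' : a.k < p := h1
      have h2' : (p : ℕ) < a.l := h2
      unfold SpecialGt InA InB InC StdGt at h3
      simp only [PosRoot.k, PosRoot.l] at h3 h1' h2' hal ⊢
      omega
    · rintro ⟨⟨h1, h3⟩, h2⟩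
      refine ⟨h1, h2, ?_⟩
      unfold SpecialGt InA InB InC StdGt
      simp only [PosRoot.k, PosRoot.l] at h1 h2 h3 hal ⊢
      omega
  rw [flips, Fintype.card_subtype]
  have h1 : (Finset.univ.filter fun p : Fin N => ∃ (h1 : a.1.1 < p) (h2 : p < a.1.2),
      SpecialGt h (⟨(a.1.1, p), h1⟩ : PosRoot N) (⟨(p, a.1.2), h2⟩ : PosRoot N)).map
        Fin.valEmbedding = Finset.Ioo (max a.k (min h a.l)) a.l := by
    ext q
    simp only [Finset.mem_map, Finset.mem_filter_univ, Fin.valEmbedding_apply]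
    constructor
    · rintro ⟨p, hp, rfl⟩
      exact (hb p).1 hp
    · intro hq
      have hqN : q < N := (Finset.mem_Ioo.1 hq).2.trans a.1.2.isLt
      exact ⟨⟨q, hqN⟩, (hb ⟨q, hqN⟩).2 hq, rfl⟩
  rw [← Finset.card_map Fin.valEmbedding, h1, Nat.card_Ioo]
  have hal := a.k_lt_l
  split_ifs <;> omega

theorem specialFactor_eq (h : ℕ) (β : Labelling N n m) (I : P N n m) (z : Fin n → ℂ) (t : Pt N m)
    (s : S I.1) : specialFactor h β I z t s =
      (-1) ^ flips h s.1.2 * weight (z s.1.1) (pivot h s.1.2) s.1.2 (coord β I t s) := by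
  rw [specialFactor, flips_eq, pivot, weight, chain]
  split_ifs <;> ring

theorem specialMonomial_eq (h : ℕ) (i : PosRoot N → ℕ) :
    specialMonomial h i =
      (∏ a, ((-1 : ℂ) ^ flips h a) ^ i a) • pbwMonomial (SpecialGt h) lowering i := by
  have h1 : ∀ a : PosRoot N, ((Nat.factorial (i a) : ℂ)⁻¹) •
      (UniversalEnvelopingAlgebra.ι ℂ (specialLowering h a)) ^ (i a) =
      ((-1 : ℂ) ^ flips h a) ^ i a • (((Nat.factorial (i a) : ℂ)⁻¹) •
        (UniversalEnvelopingAlgebra.ι ℂ (lowering a)) ^ (i a)) := by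
    intro a
    rw [specialLowering, map_smul, smul_pow, smul_comm]
  rw [specialMonomial, pbwMonomial, pbwMonomial]
  simp only [h1]
  rw [list_prod_map_smul (Finset.sort_nodup _ _)
    (fun a => (Finset.mem_sort _).2 (Finset.mem_univ a)), smul_comm]

variable {V : Fin n → Type*} [∀ j, AddCommGroup (V j)] [∀ j, Module ℂ (V j)]
  [∀ j, LieRingModule (SL N) (V j)] [∀ j, LieModule ℂ (SL N) (V j)]

theorem phi_eq (β : Labelling N n m) (v : ∀ j, V j) (z : Fin n → ℂ) : phi β v z = fun t =>
    ∑ I : P N n m, (∏ s : S I.1, weight (z s.1.1) (s.1.2.l - 1) s.1.2 (coord β I t s)) •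
      PiTensorProduct.tprod ℂ fun j => act (pbwMonomial StdGt lowering (I.1 j)) (v j) := rfl

/-- Each s in S(I) contributes the sign (-1)^{a_{k,l}(h)} twice, once from its scalar factor and
once from its root vector. -/
theorem phiSpecial_eq (h : ℕ) (β : Labelling N n m) (v : ∀ j, V j) (z : Fin n → ℂ) :
    phiSpecial h β v z = fun t =>
    ∑ I : P N n m, (∏ s : S I.1, weight (z s.1.1) (pivot h s.1.2) s.1.2 (coord β I t s)) •
      PiTensorProduct.tprod ℂ fun j => act (pbwMonomial (SpecialGt h) lowering (I.1 j)) (v j) := by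
  funext t
  refine Finset.sum_congr rfl fun I _ => ?_
  have h1 : (fun j => act (specialMonomial h (I.1 j)) (v j)) = fun j =>
      (∏ a, ((-1 : ℂ) ^ flips h a) ^ I.1 j a) •
        act (pbwMonomial (SpecialGt h) lowering (I.1 j)) (v j) := by
    funext j
    rw [specialMonomial_eq, act, map_smul]
    rfl
  rw [h1, MultilinearMap.map_smul_univ, smul_smul, specialCoeff]
  simp only [specialFactor_eq]
  rw [prod_pow_eq_prod_S I.1 fun _ a => (-1 : ℂ) ^ flips h a, mul_comm, ← Finset.prod_mul_distrib]
  congr 1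
  refine Finset.prod_congr rfl fun s _ => ?_
  rw [← mul_assoc, ← mul_pow]
  simp

end Signs

/-! ## The relations between the root vectors -/

section Relations

variable {N : ℕ}

theorem lie_lowering_eq_zero {a b : PosRoot N} (h1 : a.k ≠ b.l) (h2 : b.k ≠ a.l) :
    ⁅lowering a, lowering b⁆ = 0 := by
  apply Subtype.ext
  have h1' : a.1.1 ≠ b.1.2 := fun h => h1 (congrArg Fin.val h)
  have h2' : b.1.1 ≠ a.1.2 := fun h => h2 (congrArg Fin.val h)
  rw [LieAlgebra.SpecialLinear.sl_bracket, lowering, lowering,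
    LieAlgebra.SpecialLinear.val_single, LieAlgebra.SpecialLinear.val_single,
    Matrix.single_mul_single_of_ne _ _ _ _ h1', Matrix.single_mul_single_of_ne _ _ _ _ h2', sub_zero]
  rfl

theorem lie_lowering_eq_lowering {a b c : PosRoot N} (h1 : a.k = b.l) (h2 : c.k = b.k)
    (h3 : c.l = a.l) : ⁅lowering a, lowering b⁆ = lowering c := by
  apply Subtype.ext
  have h1' : a.1.1 = b.1.2 := Fin.ext h1
  have h2' : c.1.1 = b.1.1 := Fin.ext h2
  have h3' : c.1.2 = a.1.2 := Fin.ext h3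
  have h4 : b.1.1 ≠ a.1.2 := by
    have ha := a.k_lt_l
    have hb := b.k_lt_l
    intro h
    have : b.k = a.l := congrArg Fin.val h
    omega
  rw [LieAlgebra.SpecialLinear.sl_bracket, lowering, lowering, lowering,
    LieAlgebra.SpecialLinear.val_single, LieAlgebra.SpecialLinear.val_single,
    LieAlgebra.SpecialLinear.val_single, Matrix.single_mul_single_of_ne _ _ _ _ h4, sub_zero,
    h1', h2', h3', Matrix.single_mul_single_same, mul_one]

variable {A : Type*} [Semiring A] [Algebra ℂ A] (φ : UEA N →ₐ[ℂ] A)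

theorem map_lie_eq (x y : SL N) : φ (UniversalEnvelopingAlgebra.ι ℂ x) *
      φ (UniversalEnvelopingAlgebra.ι ℂ y) =
    φ (UniversalEnvelopingAlgebra.ι ℂ y) * φ (UniversalEnvelopingAlgebra.ι ℂ x) +
      φ (UniversalEnvelopingAlgebra.ι ℂ ⁅x, y⁆) := by
  let : LieRing (UEA N) := LieRing.ofAssociativeRing
  rw [← map_mul φ, ← map_mul φ, ← map_add φ, LieHom.map_lie, LieRing.of_associative_ring_bracket,
    add_sub_cancel]

end Relations

theorem symmetrize_phiSpecial {N n : ℕ} {m : Fin (N - 1) → ℕ} {V : Fin n → Type*}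
    [∀ j, AddCommGroup (V j)] [∀ j, Module ℂ (V j)] [∀ j, LieRingModule (SL N) (V j)]
    [∀ j, LieModule ℂ (SL N) (V j)] (v : ∀ j, V j) (β : Labelling N n m) (h : ℕ)
    (z : Fin n → ℂ) (t : Pt N m) (hzt : Regular z t) :
    symmetrize (phiSpecial h β v z) t = symmetrize (phi β v z) t := by
  -- The exponential divides by factorials; the rational scalars act through ℂ.
  let : Module ℚ (Module.End (Scalars m) (Scalars m ⊗[ℂ] (⨂[ℂ] j, V j))) :=
    Module.compHom _ (algebraMap ℚ ℂ)
  have hj : ∀ j, expProd h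
        (fun a => scalarAct (Scalars m) V j (UniversalEnvelopingAlgebra.ι ℂ (lowering a)))
        (gen (z j) t) =
      orderedProd StdGt Finset.univ fun a => IsNilpotent.exp (-(gen (z j) t (a.l - 1) a •
        scalarAct (Scalars m) V j (UniversalEnvelopingAlgebra.ι ℂ (lowering a)))) := by
    intro j
    refine expProd_eq_standard _ _ (isNilpotent_gen (z j) t) (fun a b h1 h2 => ?_)
      (fun a b c h1 h2 h3 => ?_) (gen_relation (fun p d => hzt.1 p d j) hzt.2) h
    · refine (map_lie_eq (scalarAct (Scalars m) V j) (lowering a) (lowering b)).trans ?_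
      rw [lie_lowering_eq_zero h1 h2, map_zero, map_zero]
      exact add_zero _
    · rw [← lie_lowering_eq_lowering h1 h2 h3]
      exact map_lie_eq (scalarAct (Scalars m) V j) (lowering a) (lowering b)
  rw [phiSpecial_eq, phi_eq, symmetrize_eq_topProj (SpecialGt h) lowering (pivot h) β v z t]
  simp only [expProd] at hj
  simp only [hj]
  exact (symmetrize_eq_topProj StdGt lowering (fun a => a.l - 1) β v z t).symm

end MarkovVarchenko

end

theorem theorem6p2 (N n : ℕ) (m : Fin (N - 1) → ℕ)
    (V : Fin n → Type*) [∀ j, AddCommGroup (V j)] [∀ j, Module ℂ (V j)]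
    [∀ j, LieRingModule (MarkovVarchenko.SL N) (V j)]
    [∀ j, LieModule ℂ (MarkovVarchenko.SL N) (V j)]
    (Λ : Fin n → Module.Dual ℂ (MarkovVarchenko.cartan N)) (v : ∀ j, V j)
    (hv : ∀ j, MarkovVarchenko.IsHighestWeightModule (Λ j) (v j))
    (β : MarkovVarchenko.Labelling N n m) (h : Fin (N - 1)) :
    MarkovVarchenko.IsNormalOrder (MarkovVarchenko.SpecialGt (N := N) h) ∧
    ∀ (z : Fin n → ℂ) (t : MarkovVarchenko.Pt N m), MarkovVarchenko.Regular z t →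
      MarkovVarchenko.symmetrize (MarkovVarchenko.phiSpecial h β v z) t =
        MarkovVarchenko.symmetrize (MarkovVarchenko.phi β v z) t :=
  ⟨MarkovVarchenko.isNormalOrder_specialGt N h, fun z t hzt =>
    MarkovVarchenko.symmetrize_phiSpecial v β h z t hzt⟩
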